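/- Let $K$ be a field and $A$ a finite dimensional $K$-algebra; modules are finite dimensional right modules unless stated otherwise, $D=\mathrm{Hom}_K(-,K)$, and $\mathrm{domdim}(M)$ is the supremum of all $n$ such that the first $n$ terms $I_0,\dots,I_{n-1}$ of a minimal injective resolution $0\to M\to I_0\to I_1\to\cdots$ are projective. Let $e\in A$ be an idempotent such that $eA$ is a minimal faithful projective-injective module (faithful, projective, injective, and no proper direct summand is faithful), and assume that $A$ is gendo-symmetric, i.e. $\mathrm{domdim}(A_A)\ge 2$ and $D(Ae)\cong eA$ as $(eAe,A)$-bimodules. Then $D(A)\cong Ae\otimes_{eAe}eA$ as $A$-bimodules. Fix any such isomorphism and use it to identify the two bimodules. Then $\mathcal B=(A,D(A))$ is a bocs with comultiplication $\mu(ae\otimes eb)=(ae\otimes e)\otimes(e\otimes eb)$ and counit $\epsilon(ae\otimes eb)=aeb$. Its module category $\mathcal B\text{-mod}$ has as objects the finite dimensional right $A$-modules, and $\mathrm{Hom}_{\mathcal B}(M,N)=\mathrm{Hom}_A(M,\mathrm{Hom}_A(D(A),N))$; the composite of $f\in\mathrm{Hom}_{\mathcal B}(L,M)$ and $g\in\mathrm{Hom}_{\mathcal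 B}(M,N)$ is $(g*f)(l)(w)=\sum_i g(f(l)(w_i))(w_i')$ for $\mu(w)=\sum_i w_i\otimes w_i'$, and the identity of $M$ is $m\mapsto(w\mapsto m\,\epsilon(w))$. For a module $M$ let $I_M:M\to\mathrm{Hom}_A(D(A),M)$ be given by $I_M(m)(ae\otimes eb)=maeb$, and put $\nu^{-1}(M)=\mathrm{Hom}_A(D(A),M)$. Define $\phi:\mathrm{mod}\text{-}A\to\mathcal B\text{-mod}$ by $\phi(M)=M$ and $\phi(f)=I_N f$ for $f:M\to N$. Let $\mathrm{Dom}_2\subseteq\mathrm{mod}\text{-}A$ and $\mathrm{Dom}_2^{\mathcal B}\subseteq\mathcal B\text{-mod}$ be the full subcategories of the modules of dominant dimension at least $2$. 1. $\phi$ is a $K$-linear functor. 2. $\phi(M)$ is a zero object if and only if the two-sided ideal $AeA$ annihilates $M$. Every nonzero module $M$ annihilated by $AeA$ has dominant dimension zero. 3. $\phi$ restricts to an equivalence of $K$-linear categories $\mathrm{Dom}_2\to\mathrm{Dom}_2^{\mathcal B}$. 4. Every $A$-module $M$ is isomorphic to $\nu^{-1}(M)$ in $\mathcal B\text{-mod}$.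 The categories $\mathcal B\text{-mod}$, $\mathrm{Dom}_2$ and $\mathrm{mod}\text{-}eAe$ are equivalent as $K$-linear categories. -/

import Mathlib

open CategoryTheory MulOpposite
open scoped TensorProduct

universe u

/-!
Right modules over a ring `R` are modules over `Rᵐᵒᵖ`: `x · r` is `op r • x`.
The category `mod-R` of finitely generated right `R`-modules is `FGModuleCat Rᵐᵒᵖ`.
An `(R, S)`-bimodule carries commuting actions of `R` and of `Sᵐᵒᵖ`.
-/

namespace Gendo

/-! ### Bimodule maps -/

/-- Homomorphisms of `(R, S)`-bimodules. -/
structure BimodHom (R S X Y : Type*) [Ring R] [Ring S] [AddCommGroup X] [AddCommGroup Y]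
    [Module R X] [Module Sᵐᵒᵖ X] [Module R Y] [Module Sᵐᵒᵖ Y] extends X →+ Y where
  map_left : ∀ (r : R) (x : X), toFun (r • x) = r • toFun x
  map_right : ∀ (s : S) (x : X), toFun (op s • x) = op s • toFun x

/-- Isomorphisms of `(R, S)`-bimodules. -/
structure BimodEquiv (R S X Y : Type*) [Ring R] [Ring S] [AddCommGroup X] [AddCommGroup Y]
    [Module R X] [Module Sᵐᵒᵖ X] [Module R Y] [Module Sᵐᵒᵖ Y] extends X ≃+ Y where
  map_left : ∀ (r : R) (x : X), toFun (r • x) = r • toFun x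
  map_right : ∀ (s : S) (x : X), toFun (op s • x) = op s • toFun x

section BimodMaps

variable {R S X Y : Type*} [Ring R] [Ring S] [AddCommGroup X] [AddCommGroup Y]
    [Module R X] [Module Sᵐᵒᵖ X] [Module R Y] [Module Sᵐᵒᵖ Y]

instance : FunLike (BimodHom R S X Y) X Y where
  coe f := f.toFun
  coe_injective f g h := by
    cases f; cases g; congr; exact AddMonoidHom.ext (congrFun h)

/-- The underlying left linear map. -/
def BimodHom.left (f : BimodHom R S X Y) : X →ₗ[R] Y where
  toFun := f
  map_add' := f.map_add'
  map_smul' := f.map_left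

/-- The underlying right linear map. -/
def BimodHom.right (f : BimodHom R S X Y) : X →ₗ[Sᵐᵒᵖ] Y where
  toFun := f
  map_add' := f.map_add'
  map_smul' r x := f.map_right r.unop x

/-- A bimodule isomorphism as a bimodule map. -/
def BimodEquiv.hom (f : BimodEquiv R S X Y) : BimodHom R S X Y where
  toFun := f.toFun
  map_zero' := f.toAddEquiv.map_zero
  map_add' := f.map_add'
  map_left := f.map_left
  map_right := f.map_right

/-- The inverse of a bimodule isomorphism as a bimodule map. -/
def BimodEquiv.inv (f : BimodEquiv R S X Y) : BimodHom R S Y X where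
  toFun := f.invFun
  map_zero' := f.toAddEquiv.symm.map_zero
  map_add' := f.toAddEquiv.symm.map_add
  map_left r y := f.toAddEquiv.injective <| by
    have h := f.map_left r (f.invFun y)
    have h1 : f.toFun (f.invFun y) = y := f.right_inv y
    rw [h1] at h
    exact (f.right_inv _).trans h.symm
  map_right r y := f.toAddEquiv.injective <| by
    have h := f.map_right r (f.invFun y)
    have h1 : f.toFun (f.invFun y) = y := f.right_inv y
    rw [h1] at h
    exact (f.right_inv _).trans h.symm

/-- Composition of bimodule maps. -/
def BimodHom.comp {Z : Type*} [AddCommGroup Z] [Module R Z] [Module Sᵐᵒᵖ Z]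
    (g : BimodHom R S Y Z) (f : BimodHom R S X Y) : BimodHom R S X Z where
  toAddMonoidHom := g.toAddMonoidHom.comp f.toAddMonoidHom
  map_left r x := (congrArg g (f.map_left r x)).trans (g.map_left r (f x))
  map_right s x := (congrArg g (f.map_right s x)).trans (g.map_right s (f x))

lemma BimodEquiv.hom_inv (f : BimodEquiv R S X Y) (y : Y) : f.hom (f.inv y) = y :=
  f.right_inv y

lemma BimodEquiv.inv_hom (f : BimodEquiv R S X Y) (x : X) : f.inv (f.hom x) = x :=
  f.left_inv x

end BimodMaps

/-! ### The tensor product over a noncommutative ring -/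

/-- The relations `x r ⊗ y = x ⊗ r y`. -/
def balRel (R X Y : Type*) [Ring R] [AddCommGroup X] [AddCommGroup Y]
    [Module Rᵐᵒᵖ X] [Module R Y] : Submodule ℤ (X ⊗[ℤ] Y) :=
  Submodule.span ℤ {t | ∃ (x : X) (r : R) (y : Y), t = (op r • x) ⊗ₜ[ℤ] y - x ⊗ₜ[ℤ] (r • y)}

/-- The tensor product `X ⊗_R Y` of a right `R`-module and a left `R`-module. -/
def BTensor (R X Y : Type*) [Ring R] [AddCommGroup X] [AddCommGroup Y]
    [Module Rᵐᵒᵖ X] [Module R Y] : Type _ :=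
  (X ⊗[ℤ] Y) ⧸ balRel R X Y

namespace BTensor

variable {R X Y : Type*} [Ring R] [AddCommGroup X] [AddCommGroup Y]
    [Module Rᵐᵒᵖ X] [Module R Y]

instance : AddCommGroup (BTensor R X Y) :=
  inferInstanceAs (AddCommGroup ((X ⊗[ℤ] Y) ⧸ balRel R X Y))

/-- The pure tensor `x ⊗ y` in `X ⊗_R Y`. -/
def tmul (R : Type*) {X Y : Type*} [Ring R] [AddCommGroup X] [AddCommGroup Y]
    [Module Rᵐᵒᵖ X] [Module R Y] (x : X) (y : Y) : BTensor R X Y :=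
  (balRel R X Y).mkQ (x ⊗ₜ[ℤ] y)

lemma add_tmul (x x' : X) (y : Y) : tmul R (x + x') y = tmul R x y + tmul R x' y := by
  simp only [tmul, TensorProduct.add_tmul, map_add]; rfl

lemma tmul_add (x : X) (y y' : Y) : tmul R x (y + y') = tmul R x y + tmul R x y' := by
  simp only [tmul, TensorProduct.tmul_add, map_add]; rfl

lemma op_smul_tmul (r : R) (x : X) (y : Y) : tmul R (op r • x) y = tmul R x (r • y) :=
  (Submodule.Quotient.eq _).2 (Submodule.subset_span ⟨x, r, y, rfl⟩)

@[simp] lemma zero_tmul (y : Y) : tmul R (0 : X) y = 0 := by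
  have h := add_tmul (R := R) (0 : X) 0 y
  rw [add_zero] at h
  exact left_eq_add.1 h

@[simp] lemma tmul_zero (x : X) : tmul R x (0 : Y) = 0 := by
  have h := tmul_add (R := R) x (0 : Y) 0
  rw [add_zero] at h
  exact left_eq_add.1 h

@[elab_as_elim]
lemma induction_on {p : BTensor R X Y → Prop} (t : BTensor R X Y) (zero : p 0)
    (tmul : ∀ x y, p (tmul R x y)) (add : ∀ s t, p s → p t → p (s + t)) : p t := by
  obtain ⟨t, rfl⟩ := (balRel R X Y).mkQ_surjective t
  induction t using TensorProduct.induction_on with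
  | zero => exact zero
  | tmul x y => exact tmul x y
  | add s t hs ht => rw [map_add]; exact add _ _ hs ht

/-- The universal property of the tensor product: balanced biadditive maps. -/
def lift {Z : Type*} [AddCommGroup Z] (f : X → Y → Z)
    (hx : ∀ x x' y, f (x + x') y = f x y + f x' y) (hy : ∀ x y y', f x (y + y') = f x y + f x y')
    (hf : ∀ x (r : R) y, f (op r • x) y = f x (r • y)) : BTensor R X Y →+ Z :=
  ((balRel R X Y).liftQ
    (TensorProduct.liftAddHom (AddMonoidHom.mk' (fun x => AddMonoidHom.mk' (f x) (hy x))
      (fun x x' => AddMonoidHom.ext fun y => hx x x' y))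
      (fun n x y => by simp only [map_zsmul, AddMonoidHom.coe_smul, Pi.smul_apply])
      ).toIntLinearMap (by
      rw [balRel, Submodule.span_le]
      rintro _ ⟨x, r, y, rfl⟩
      simp [hf])).toAddMonoidHom

@[simp] lemma lift_tmul {Z : Type*} [AddCommGroup Z] (f : X → Y → Z)
    (hx : ∀ x x' y, f (x + x') y = f x y + f x' y) (hy : ∀ x y y', f x (y + y') = f x y + f x y')
    (hf : ∀ x (r : R) y, f (op r • x) y = f x (r • y)) (x : X) (y : Y) :
    lift f hx hy hf (tmul R x y) = f x y := rfl

/-- The map `f ⊗ g : X ⊗_R Y → X' ⊗_R Y'`. -/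
def tmap {X' Y' : Type*} [AddCommGroup X'] [AddCommGroup Y'] [Module Rᵐᵒᵖ X'] [Module R Y']
    (f : X →ₗ[Rᵐᵒᵖ] X') (g : Y →ₗ[R] Y') : BTensor R X Y →+ BTensor R X' Y' :=
  lift (fun x y => tmul R (f x) (g y)) (fun x x' y => by rw [map_add, add_tmul])
    (fun x y y' => by rw [map_add, tmul_add]) (fun x r y => by simp [op_smul_tmul])

@[simp] lemma tmap_tmul {X' Y' : Type*} [AddCommGroup X'] [AddCommGroup Y'] [Module Rᵐᵒᵖ X']
    [Module R Y'] (f : X →ₗ[Rᵐᵒᵖ] X') (g : Y →ₗ[R] Y') (x : X) (y : Y) :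
    tmap f g (tmul R x y) = tmul R (f x) (g y) := rfl

lemma hom_ext {Z : Type*} [AddCommGroup Z] {f g : BTensor R X Y →+ Z}
    (h : ∀ x y, f (tmul R x y) = g (tmul R x y)) : f = g := by
  ext t
  induction t using induction_on with
  | zero => simp
  | tmul x y => exact h x y
  | add s t hs ht => rw [map_add, map_add, hs, ht]

/-- Left multiplication `s · (x ⊗ y) = s x ⊗ y`. -/
def lsmul {S : Type*} [Ring S] [Module S X] [SMulCommClass S Rᵐᵒᵖ X] (s : S) :
    BTensor R X Y →+ BTensor R X Y :=
  tmap ⟨⟨fun x => s • x, smul_add s⟩, fun r x => smul_comm s r x⟩ LinearMap.id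

/-- If `X` is an `(S, R)`-bimodule then `X ⊗_R Y` is a left `S`-module. -/
instance {S : Type*} [Ring S] [Module S X] [SMulCommClass S Rᵐᵒᵖ X] :
    Module S (BTensor R X Y) where
  smul s t := lsmul s t
  one_smul t := DFunLike.congr_fun (f := lsmul (1 : S)) (g := AddMonoidHom.id (BTensor R X Y))
    (hom_ext fun x y => by simp [lsmul]) t
  mul_smul s s' t := DFunLike.congr_fun (f := lsmul (s * s'))
    (g := (lsmul s).comp (lsmul s')) (hom_ext fun x y => by simp [lsmul, mul_smul]) t
  smul_zero s := map_zero (lsmul s)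
  smul_add s := map_add (lsmul s)
  add_smul s s' t := DFunLike.congr_fun (f := lsmul (s + s'))
    (g := lsmul s + lsmul s') (hom_ext fun x y => by simp [lsmul, add_smul, add_tmul]) t
  zero_smul t := DFunLike.congr_fun (f := lsmul (0 : S)) (g := (0 : BTensor R X Y →+ _))
    (hom_ext fun x y => by
      change tmul R ((0 : S) • x) y = 0
      rw [zero_smul, zero_tmul]) t

/-- Right multiplication `(x ⊗ y) · s = x ⊗ y s`. -/
def rsmul {T : Type*} [Ring T] [Module Tᵐᵒᵖ Y] [SMulCommClass R Tᵐᵒᵖ Y] (s : Tᵐᵒᵖ) :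
    BTensor R X Y →+ BTensor R X Y :=
  tmap LinearMap.id ⟨⟨fun y => s • y, smul_add s⟩, fun r y => (smul_comm r s y).symm⟩

/-- If `Y` is an `(R, T)`-bimodule then `X ⊗_R Y` is a right `T`-module. -/
instance {T : Type*} [Ring T] [Module Tᵐᵒᵖ Y] [SMulCommClass R Tᵐᵒᵖ Y] :
    Module Tᵐᵒᵖ (BTensor R X Y) where
  smul s t := rsmul s t
  one_smul t := DFunLike.congr_fun (f := rsmul (1 : Tᵐᵒᵖ)) (g := AddMonoidHom.id (BTensor R X Y))
    (hom_ext fun x y => by simp [rsmul]) t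
  mul_smul s s' t := DFunLike.congr_fun (f := rsmul (s * s'))
    (g := (rsmul s).comp (rsmul s')) (hom_ext fun x y => by simp [rsmul, mul_smul]) t
  smul_zero s := map_zero (rsmul s)
  smul_add s := map_add (rsmul s)
  add_smul s s' t := DFunLike.congr_fun (f := rsmul (s + s'))
    (g := rsmul s + rsmul s') (hom_ext fun x y => by simp [rsmul, add_smul, tmul_add]) t
  zero_smul t := DFunLike.congr_fun (f := rsmul (0 : Tᵐᵒᵖ)) (g := (0 : BTensor R X Y →+ _))
    (hom_ext fun x y => by
      change tmul R x ((0 : Tᵐᵒᵖ) • y) = 0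
      rw [zero_smul, tmul_zero]) t

@[simp] lemma smul_tmul {S : Type*} [Ring S] [Module S X] [SMulCommClass S Rᵐᵒᵖ X] (s : S)
    (x : X) (y : Y) : s • tmul R x y = tmul R (s • x) y := rfl

@[simp] lemma op_smul_tmul' {T : Type*} [Ring T] [Module Tᵐᵒᵖ Y] [SMulCommClass R Tᵐᵒᵖ Y]
    (s : Tᵐᵒᵖ) (x : X) (y : Y) : s • tmul R x y = tmul R x (s • y) := rfl

instance {S T : Type*} [Ring S] [Module S X] [SMulCommClass S Rᵐᵒᵖ X]
    [Ring T] [Module Tᵐᵒᵖ Y] [SMulCommClass R Tᵐᵒᵖ Y] :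
    SMulCommClass S Tᵐᵒᵖ (BTensor R X Y) where
  smul_comm s r t := by
    induction t using induction_on with
    | zero => simp
    | tmul x y => simp
    | add a b ha hb => simp only [smul_add, ha, hb]

/-- The associativity map `(X ⊗_R Y) ⊗_S Z → X ⊗_R (Y ⊗_S Z)`, `(x ⊗ y) ⊗ z ↦ x ⊗ (y ⊗ z)`. -/
def assoc {R S X Y Z : Type*} [Ring R] [Ring S] [AddCommGroup X] [AddCommGroup Y]
    [AddCommGroup Z] [Module Rᵐᵒᵖ X] [Module R Y] [Module Sᵐᵒᵖ Y] [SMulCommClass R Sᵐᵒᵖ Y]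
    [Module S Z] : BTensor S (BTensor R X Y) Z →+ BTensor R X (BTensor S Y Z) :=
  lift (fun t z => lift (fun x y => tmul R x (tmul S y z))
      (fun x x' y => by rw [add_tmul]) (fun x y y' => by rw [add_tmul, tmul_add])
      (fun x r y => by rw [op_smul_tmul, smul_tmul]) t)
    (fun t t' z => map_add _ t t')
    (fun t z z' => by
      induction t using induction_on with
      | zero => simp only [map_zero, add_zero]
      | tmul x y => simp only [lift_tmul, tmul_add]
      | add a b ha hb => simp only [map_add, ha, hb]; abel)
    (fun t s z => by
      induction t using induction_on with
      | zero => simp only [smul_zero, map_zero]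
      | tmul x y => simp only [op_smul_tmul', lift_tmul, op_smul_tmul]
      | add a b ha hb => simp only [smul_add, map_add, ha, hb])

@[simp] lemma assoc_tmul {R S X Y Z : Type*} [Ring R] [Ring S] [AddCommGroup X] [AddCommGroup Y]
    [AddCommGroup Z] [Module Rᵐᵒᵖ X] [Module R Y] [Module Sᵐᵒᵖ Y] [SMulCommClass R Sᵐᵒᵖ Y]
    [Module S Z] (x : X) (y : Y) (z : Z) :
    assoc (tmul S (tmul R x y) z) = tmul R x (tmul S y z) := rfl

end BTensor

open BTensor

/-! ### Bocses and their module categories -/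

/-- A bocs `(A, W)`: an `A`-bimodule `W` with a coassociative comultiplication and a counit. -/
structure Bocs (A W : Type*) [Ring A] [AddCommGroup W] [Module A W] [Module Aᵐᵒᵖ W]
    [SMulCommClass A Aᵐᵒᵖ W] where
  comul : BimodHom A A W (BTensor A W W)
  counit : BimodHom A A W A
  map_id_counit : ∀ w, tmap LinearMap.id counit.left (comul w) = tmul A w (1 : A)
  map_counit_id : ∀ w, tmap counit.right LinearMap.id (comul w) = tmul A (1 : A) w
  coassoc : ∀ w, assoc (tmap comul.right LinearMap.id (comul w)) =
    tmap LinearMap.id comul.left (comul w)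

/-- The right `A`-module `Hom_A(W, N)` of right `A`-linear maps, with `(h · a)(w) = h(a w)`. -/
def RHom (A W N : Type*) [Ring A] [AddCommGroup W] [Module Aᵐᵒᵖ W]
    [AddCommGroup N] [Module Aᵐᵒᵖ N] : Type _ :=
  W →ₗ[Aᵐᵒᵖ] N

namespace RHom

variable {A W N : Type*} [Ring A] [AddCommGroup W] [Module A W] [Module Aᵐᵒᵖ W]
    [SMulCommClass A Aᵐᵒᵖ W] [AddCommGroup N] [Module Aᵐᵒᵖ N]

instance : AddCommGroup (RHom A W N) := inferInstanceAs (AddCommGroup (W →ₗ[Aᵐᵒᵖ] N))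

instance : FunLike (RHom A W N) W N := inferInstanceAs (FunLike (W →ₗ[Aᵐᵒᵖ] N) W N)

instance : LinearMapClass (RHom A W N) Aᵐᵒᵖ W N :=
  inferInstanceAs (LinearMapClass (W →ₗ[Aᵐᵒᵖ] N) Aᵐᵒᵖ W N)

@[ext] lemma ext {f g : RHom A W N} (h : ∀ w, f w = g w) : f = g := LinearMap.ext h

@[simp] lemma add_apply (f g : RHom A W N) (w : W) : (f + g) w = f w + g w := rfl

@[simp] lemma zero_apply (w : W) : (0 : RHom A W N) w = 0 := rfl

instance : Module Aᵐᵒᵖ (RHom A W N) where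
  smul a h := (LinearMap.mk ⟨fun w => h (a.unop • w), fun x y => by rw [smul_add, map_add]⟩
    fun r w => by
      change h (a.unop • r • w) = r • h (a.unop • w)
      rw [smul_comm, map_smul] : W →ₗ[Aᵐᵒᵖ] N)
  one_smul h := by ext w; change h ((1 : A) • w) = h w; rw [one_smul]
  mul_smul a b h := by
    ext w
    change h ((b.unop * a.unop) • w) = h (b.unop • a.unop • w)
    rw [mul_smul]
  smul_zero a := rfl
  smul_add a f g := rfl
  add_smul a b h := by
    ext w
    change h ((a.unop + b.unop) • w) = h (a.unop • w) + h (b.unop • w)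
    rw [add_smul, map_add]
  zero_smul h := by ext w; change h ((0 : A) • w) = 0; rw [zero_smul, map_zero]

@[simp] lemma smul_apply (a : Aᵐᵒᵖ) (h : RHom A W N) (w : W) : (a • h) w = h (a.unop • w) := rfl

end RHom

section Convolution

variable {A W L M N : Type*} [Ring A] [AddCommGroup W] [Module A W] [Module Aᵐᵒᵖ W]
    [SMulCommClass A Aᵐᵒᵖ W] [AddCommGroup L] [Module Aᵐᵒᵖ L] [AddCommGroup M] [Module Aᵐᵒᵖ M]
    [AddCommGroup N] [Module Aᵐᵒᵖ N]

/-- The adjunction map `ψ : Hom_A(W, Hom_A(W, N)) → Hom_A(W ⊗_A W, N)`,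
`ψ(h)(w ⊗ w') = h(w)(w')`. -/
def adj (h : RHom A W (RHom A W N)) : RHom A (BTensor A W W) N :=
  (LinearMap.mk (lift (fun w w' => h w w') (fun x y w' => by simp)
      (fun w x y => map_add _ x y) (fun w r w' => by simp)).toAddHom
    (fun r t => by
      change lift _ _ _ _ (r • t) = r • lift _ _ _ _ t
      induction t using induction_on with
      | zero => simp
      | tmul x y => simp
      | add a b ha hb => rw [smul_add, map_add, map_add, smul_add, ha, hb]) :
    BTensor A W W →ₗ[Aᵐᵒᵖ] N)

@[simp] lemma adj_tmul (h : RHom A W (RHom A W N)) (w w' : W) :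
    adj h (tmul A w w') = h w w' := rfl

/-- `Hom_A(W, g) : Hom_A(W, M) → Hom_A(W, M')`. -/
def postComp (g : M →ₗ[Aᵐᵒᵖ] N) (h : RHom A W M) : RHom A W N :=
  LinearMap.comp (σ₁₂ := RingHom.id Aᵐᵒᵖ) (σ₂₃ := RingHom.id Aᵐᵒᵖ) g (h : W →ₗ[Aᵐᵒᵖ] M)

@[simp] lemma postComp_apply (g : M →ₗ[Aᵐᵒᵖ] N) (h : RHom A W M) (w : W) :
    postComp g h w = g (h w) := rfl

lemma adj_add (h h' : RHom A W (RHom A W N)) (t : BTensor A W W) :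
    adj (h + h') t = adj h t + adj h' t := by
  induction t using induction_on with
  | zero => simp
  | tmul x y => simp
  | add a b ha hb => rw [map_add, map_add, map_add, ha, hb]; abel

lemma adj_smul (g : M →ₗ[Aᵐᵒᵖ] RHom A W N) (h : RHom A W M) (a : Aᵐᵒᵖ) (t : BTensor A W W) :
    adj (postComp g (a • h)) t = adj (postComp g h) (a.unop • t) := by
  induction t using induction_on with
  | zero => simp
  | tmul x y => simp
  | add a b ha hb => rw [map_add, smul_add, map_add, ha, hb]

/-- Composition in the module category of a bocs:
`g * f = Hom_A(μ, N) ∘ ψ ∘ Hom_A(W, g) ∘ f`. -/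
def Bocs.conv (β : Bocs A W) (g : M →ₗ[Aᵐᵒᵖ] RHom A W N) (f : L →ₗ[Aᵐᵒᵖ] RHom A W M) :
    L →ₗ[Aᵐᵒᵖ] RHom A W N where
  toFun l := LinearMap.comp (σ₁₂ := RingHom.id Aᵐᵒᵖ) (σ₂₃ := RingHom.id Aᵐᵒᵖ)
    (adj (postComp g (f l)) : BTensor A W W →ₗ[Aᵐᵒᵖ] N) β.comul.right
  map_add' x y := by
    refine RHom.ext fun w => ?_
    change adj (postComp g (f (x + y))) (β.comul w) =
      adj (postComp g (f x)) (β.comul w) + adj (postComp g (f y)) (β.comul w)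
    rw [← adj_add, map_add]
    congr 1
    congr 1
    refine RHom.ext fun w => ?_
    simp
  map_smul' a x := by
    refine RHom.ext fun w => ?_
    change adj (postComp g (f (a • x))) (β.comul w) =
      adj (postComp g (f x)) (β.comul (a.unop • w))
    rw [map_smul, adj_smul]
    congr 1
    exact (β.comul.map_left a.unop w).symm

lemma Bocs.conv_apply (β : Bocs A W) (g : M →ₗ[Aᵐᵒᵖ] RHom A W N) (f : L →ₗ[Aᵐᵒᵖ] RHom A W M)
    (l : L) (w : W) : β.conv g f l w = adj (postComp g (f l)) (β.comul w) := rfl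

/-- The unit `1_M = Hom_A(ε, M) ∘ ξ`, that is `1_M(m)(w) = m · ε(w)`. -/
def Bocs.unit (β : Bocs A W) (M : Type*) [AddCommGroup M] [Module Aᵐᵒᵖ M] :
    M →ₗ[Aᵐᵒᵖ] RHom A W M where
  toFun m := (LinearMap.mk ⟨fun w => op (β.counit w) • m, fun x y => by
      rw [show β.counit (x + y) = β.counit x + β.counit y from β.counit.map_add' x y, MulOpposite.op_add,
        add_smul]⟩
    (fun r w => by
      change op (β.counit (r • w)) • m = r • op (β.counit w) • m
      rw [show β.counit (r • w) = r • β.counit w from β.counit.map_right r.unop w, ← mul_smul]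
      rfl) : W →ₗ[Aᵐᵒᵖ] M)
  map_add' x y := RHom.ext fun w => smul_add _ x y
  map_smul' a m := RHom.ext fun w => by
    change op (β.counit w) • a • m = op (β.counit (a.unop • w)) • m
    rw [show β.counit (a.unop • w) = a.unop • β.counit w from β.counit.map_left a.unop w,
      ← mul_smul]
    rfl

lemma Bocs.unit_apply (β : Bocs A W) (m : M) (w : W) : β.unit M m w = op (β.counit w) • m := rfl

lemma Bocs.conv_unit (β : Bocs A W) (f : L →ₗ[Aᵐᵒᵖ] RHom A W M) : β.conv f (β.unit L) = f := by
  refine LinearMap.ext fun l => RHom.ext fun w => ?_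
  rw [Bocs.conv_apply]
  let c : BTensor A A W →+ W := lift (fun a w => a • w) (fun a b w => add_smul a b w)
    (fun a => smul_add a) (fun a r w => by simp [mul_smul])
  have key : ∀ t : BTensor A W W, adj (postComp f (β.unit L l)) t =
      f l (c (tmap β.counit.right LinearMap.id t)) := by
    intro t
    induction t using induction_on with
    | zero => simp
    | tmul x y =>
      rw [adj_tmul, postComp_apply, Bocs.unit_apply, map_smul]
      rfl
    | add a b ha hb => rw [map_add, ha, hb, map_add, map_add, map_add]
  rw [key, β.map_counit_id]
  change f l ((1 : A) • w) = _
  rw [one_smul]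

lemma Bocs.unit_conv (β : Bocs A W) (f : L →ₗ[Aᵐᵒᵖ] RHom A W M) : β.conv (β.unit M) f = f := by
  refine LinearMap.ext fun l => RHom.ext fun w => ?_
  rw [Bocs.conv_apply]
  let c : BTensor A W A →+ W := lift (fun w a => op a • w) (fun x y a => smul_add _ x y)
    (fun w a b => by rw [MulOpposite.op_add, add_smul]) (fun w r a => by simp [mul_smul])
  have key : ∀ t : BTensor A W W, adj (postComp (β.unit M) (f l)) t =
      f l (c (tmap LinearMap.id β.counit.left t)) := by
    intro t
    induction t using induction_on with
    | zero => simp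
    | tmul x y =>
      rw [adj_tmul, postComp_apply, Bocs.unit_apply, ← map_smul]
      rfl
    | add a b ha hb => rw [map_add, ha, hb, map_add, map_add, map_add]
  rw [key, β.map_id_counit]
  change f l (op (1 : A) • w) = _
  rw [op_one, one_smul]

lemma Bocs.conv_assoc {P : Type*} [AddCommGroup P] [Module Aᵐᵒᵖ P] (β : Bocs A W)
    (h : N →ₗ[Aᵐᵒᵖ] RHom A W P) (g : M →ₗ[Aᵐᵒᵖ] RHom A W N) (f : L →ₗ[Aᵐᵒᵖ] RHom A W M) :
    β.conv h (β.conv g f) = β.conv (β.conv h g) f := by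
  refine LinearMap.ext fun l => RHom.ext fun w => ?_
  rw [Bocs.conv_apply, Bocs.conv_apply]
  -- the triple evaluation `w₁ ⊗ t ↦ ψ(Hom_A(W, h) (g (f l w₁)))(t)`
  let c : BTensor A W (BTensor A W W) →+ P := lift (fun w₁ t => adj (postComp h (g (f l w₁))) t)
    (fun x y t => by
      rw [← adj_add]
      congr 1
      congr 1
      exact RHom.ext fun w => by simp)
    (fun x s t => map_add _ s t)
    (fun w₁ r t => by
      rw [map_smul, map_smul, adj_smul]; rfl)
  have h1 : ∀ t : BTensor A W W, adj (postComp h (β.conv g f l)) t =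
      c (assoc (tmap β.comul.right LinearMap.id t)) := by
    intro t
    induction t using induction_on with
    | zero => simp
    | tmul x y =>
      rw [adj_tmul, postComp_apply, Bocs.conv_apply, tmap_tmul]
      change h (adj (postComp g (f l)) (β.comul x)) y = c (assoc (tmul A (β.comul x) y))
      generalize β.comul x = s
      induction s using induction_on with
      | zero =>
        simp
      | tmul a b => rfl
      | add a b ha hb => rw [map_add, map_add, add_tmul, map_add, map_add, ← ha, ← hb]; rfl
    | add a b ha hb => rw [map_add, ha, hb, map_add, map_add, map_add]
  have h2 : ∀ t : BTensor A W W, adj (postComp (β.conv h g) (f l)) t =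
      c (tmap LinearMap.id β.comul.left t) := by
    intro t
    induction t using induction_on with
    | zero => simp
    | tmul x y => rfl
    | add a b ha hb => rw [map_add, ha, hb, map_add, map_add]
  rw [h1, h2, β.coassoc]

lemma Bocs.conv_add_right (β : Bocs A W) (g : M →ₗ[Aᵐᵒᵖ] RHom A W N)
    (f f' : L →ₗ[Aᵐᵒᵖ] RHom A W M) : β.conv g (f + f') = β.conv g f + β.conv g f' := by
  refine LinearMap.ext fun l => RHom.ext fun w => ?_
  change adj (postComp g (f l + f' l)) (β.comul w) =
    adj (postComp g (f l)) (β.comul w) + adj (postComp g (f' l)) (β.comul w)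
  rw [← adj_add]
  congr 1
  congr 1
  exact RHom.ext fun w => by simp

lemma Bocs.conv_add_left (β : Bocs A W) (g g' : M →ₗ[Aᵐᵒᵖ] RHom A W N)
    (f : L →ₗ[Aᵐᵒᵖ] RHom A W M) : β.conv (g + g') f = β.conv g f + β.conv g' f := by
  refine LinearMap.ext fun l => RHom.ext fun w => ?_
  change adj (postComp (g + g') (f l)) (β.comul w) =
    adj (postComp g (f l)) (β.comul w) + adj (postComp g' (f l)) (β.comul w)
  rw [← adj_add]
  rfl

end Convolution

/-- An object of the module category of a bocs `(A, W)`: a finitely generated right `A`-module. -/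
structure BocsMod {A W : Type u} [Ring A] [AddCommGroup W] [Module A W] [Module Aᵐᵒᵖ W]
    [SMulCommClass A Aᵐᵒᵖ W] (β : Bocs A W) : Type (u + 1) where
  toMod : FGModuleCat.{u} Aᵐᵒᵖ

namespace BocsMod

variable {A W : Type u} [Ring A] [AddCommGroup W] [Module A W] [Module Aᵐᵒᵖ W]
    [SMulCommClass A Aᵐᵒᵖ W] {β : Bocs A W}

/-- The module category of a bocs: `Hom(M, N) = Hom_A(M, Hom_A(W, N))`. -/
instance : Category.{u} (BocsMod β) where
  Hom M N := M.toMod →ₗ[Aᵐᵒᵖ] RHom A W N.toMod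
  id M := β.unit M.toMod
  comp f g := β.conv g f
  id_comp f := β.conv_unit f
  comp_id f := β.unit_conv f
  assoc f g h := β.conv_assoc h g f

instance : Preadditive (BocsMod β) where
  homGroup M N := inferInstanceAs (AddCommGroup (M.toMod →ₗ[Aᵐᵒᵖ] RHom A W N.toMod))
  add_comp _ _ _ f f' g := β.conv_add_right g f f'
  comp_add _ _ _ f g g' := β.conv_add_left g g' f

end BocsMod

/-- The two `K`-actions on an `A`-bimodule (from the left and from the right) agree. -/
class Central (K A W : Type*) [Field K] [Ring A] [Algebra K A] [AddCommGroup W] [Module A W]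
    [Module Aᵐᵒᵖ W] : Prop where
  smul_eq : ∀ (k : K) (w : W), algebraMap K A k • w = op (algebraMap K A k) • w

/-- The `K`-action on `Hom_A(M, Hom_A(W, N))`. -/
@[reducible] def homModule (K A W M N : Type*) [Field K] [Ring A] [Algebra K A] [AddCommGroup W]
    [Module A W] [Module Aᵐᵒᵖ W] [SMulCommClass A Aᵐᵒᵖ W] [AddCommGroup M] [Module Aᵐᵒᵖ M]
    [AddCommGroup N] [Module Aᵐᵒᵖ N] : Module K (M →ₗ[Aᵐᵒᵖ] RHom A W N) where
  smul k f :=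
    { toFun := fun m => op (algebraMap K A k) • f m
      map_add' := fun x y => by rw [map_add, smul_add]
      map_smul' := fun a m => by
        rw [map_smul, ← mul_smul]
        change _ = a • op (algebraMap K A k) • f m
        rw [← mul_smul]
        congr 1
        exact unop_injective (Algebra.commutes k a.unop).symm }
  one_smul f := LinearMap.ext fun m => by
    change op (algebraMap K A 1) • f m = f m
    rw [map_one, op_one, one_smul]
  mul_smul k k' f := LinearMap.ext fun m => by
    change op (algebraMap K A (k * k')) • f m = op (algebraMap K A k) • op (algebraMap K A k') • f m
    rw [← mul_smul, ← op_mul, ← map_mul, mul_comm]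
  smul_zero k := LinearMap.ext fun m => smul_zero _
  smul_add k f g := LinearMap.ext fun m => smul_add _ _ _
  add_smul k k' f := LinearMap.ext fun m => by
    change op (algebraMap K A (k + k')) • f m =
      op (algebraMap K A k) • f m + op (algebraMap K A k') • f m
    rw [map_add, MulOpposite.op_add, add_smul]
  zero_smul f := LinearMap.ext fun m => by
    change op (algebraMap K A 0) • f m = 0
    rw [map_zero, op_zero, zero_smul]

section KLinear

variable {K A W L M N : Type*} [Field K] [Ring A] [Algebra K A] [AddCommGroup W] [Module A W]
    [Module Aᵐᵒᵖ W] [SMulCommClass A Aᵐᵒᵖ W] [AddCommGroup L] [Module Aᵐᵒᵖ L] [AddCommGroup M]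
    [Module Aᵐᵒᵖ M] [AddCommGroup N] [Module Aᵐᵒᵖ N]

lemma Bocs.conv_smul_right (β : Bocs A W) (k : K) (g : M →ₗ[Aᵐᵒᵖ] RHom A W N)
    (f : L →ₗ[Aᵐᵒᵖ] RHom A W M) :
    letI := homModule K A W L M
    letI := homModule K A W L N
    β.conv g (k • f) = k • β.conv g f := by
  refine LinearMap.ext fun l => RHom.ext fun w => ?_
  change adj (postComp g (op (algebraMap K A k) • f l)) (β.comul w) =
    adj (postComp g (f l)) (β.comul (algebraMap K A k • w))
  rw [adj_smul]
  congr 1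
  exact (β.comul.map_left _ w).symm

lemma Bocs.conv_smul_left [Central K A W] (β : Bocs A W) (k : K) (g : M →ₗ[Aᵐᵒᵖ] RHom A W N)
    (f : L →ₗ[Aᵐᵒᵖ] RHom A W M) :
    letI := homModule K A W M N
    letI := homModule K A W L N
    β.conv (k • g) f = k • β.conv g f := by
  let _ := homModule K A W M N
  refine LinearMap.ext fun l => RHom.ext fun w => ?_
  change adj (postComp (k • g) (f l)) (β.comul w) =
    adj (postComp g (f l)) (β.comul (algebraMap K A k • w))
  rw [Central.smul_eq, show β.comul (op (algebraMap K A k) • w) =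
    op (algebraMap K A k) • β.comul w from β.comul.map_right _ w]
  generalize β.comul w = t
  induction t using induction_on with
  | zero => simp
  | tmul x y =>
    rw [op_smul_tmul', adj_tmul, adj_tmul, ← Central.smul_eq]
    rfl
  | add a b ha hb => rw [smul_add, map_add, map_add, ha, hb]

end KLinear

/-- The module category of a bocs is `K`-linear. -/
instance BocsMod.linear (K : Type*) {A W : Type u} [Field K] [Ring A] [Algebra K A]
    [AddCommGroup W] [Module A W] [Module Aᵐᵒᵖ W] [SMulCommClass A Aᵐᵒᵖ W] [Central K A W]
    {β : Bocs A W} : Linear K (BocsMod β) where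
  homModule M N := homModule K A W M.toMod N.toMod
  smul_comp _ _ _ k f g := β.conv_smul_right k g f
  comp_smul _ _ _ f k g := β.conv_smul_left k g f

/-- Two `K`-linear categories are equivalent as `K`-linear categories. -/
def LinearEquivalent (K : Type*) [Field K] (C D : Type*) [Category* C] [Category* D]
    [Preadditive C] [Preadditive D] [Linear K C] [Linear K D] : Prop :=
  ∃ F : C ⥤ D, F.IsEquivalence ∧ F.Additive ∧ F.Linear K

/-! ### The duality `D = Hom_K(-, K)` -/

/-- The `K`-dual `D(X)`. If `X` is an `(A, B)`-bimodule, then `D(X)` is a `(B, A)`-bimodule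
through `(b f)(x) = f(x b)` and `(f a)(x) = f(a x)`. -/
def KDual (K X : Type*) [Field K] [AddCommGroup X] [Module K X] : Type _ := X →ₗ[K] K

namespace KDual

variable {K X : Type*} [Field K] [AddCommGroup X] [Module K X]

instance : AddCommGroup (KDual K X) := inferInstanceAs (AddCommGroup (X →ₗ[K] K))

instance : FunLike (KDual K X) X K := inferInstanceAs (FunLike (X →ₗ[K] K) X K)

instance : LinearMapClass (KDual K X) K X K :=
  inferInstanceAs (LinearMapClass (X →ₗ[K] K) K X K)

@[ext] lemma ext {f g : KDual K X} (h : ∀ x, f x = g x) : f = g := LinearMap.ext h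

instance {A : Type*} [Ring A] [Module A X] [SMulCommClass A K X] : Module Aᵐᵒᵖ (KDual K X) where
  smul a f := (LinearMap.mk ⟨fun x => f (a.unop • x), fun x y => by rw [smul_add, map_add]⟩
    (fun k x => by
      change f (a.unop • k • x) = k • f (a.unop • x)
      rw [smul_comm, map_smul]) : X →ₗ[K] K)
  one_smul f := by ext x; change f ((1 : A) • x) = f x; rw [one_smul]
  mul_smul a b f := by
    ext x; change f ((b.unop * a.unop) • x) = f (b.unop • a.unop • x); rw [mul_smul]
  smul_zero a := rfl
  smul_add a f g := rfl
  add_smul a b f := by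
    ext x
    change f ((a.unop + b.unop) • x) = f (a.unop • x) + f (b.unop • x)
    rw [add_smul, map_add]
  zero_smul f := by ext x; change f ((0 : A) • x) = 0; rw [zero_smul, map_zero]

instance {B : Type*} [Ring B] [Module Bᵐᵒᵖ X] [SMulCommClass Bᵐᵒᵖ K X] : Module B (KDual K X) where
  smul b f := (LinearMap.mk ⟨fun x => f (op b • x), fun x y => by rw [smul_add, map_add]⟩
    (fun k x => by
      change f (op b • k • x) = k • f (op b • x)
      rw [smul_comm, map_smul]) : X →ₗ[K] K)
  one_smul f := by ext x; change f (op (1 : B) • x) = f x; rw [op_one, one_smul]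
  mul_smul a b f := by
    ext x; change f (op (a * b) • x) = f (op b • op a • x); rw [op_mul, mul_smul]
  smul_zero a := rfl
  smul_add a f g := rfl
  add_smul a b f := by
    ext x
    change f (op (a + b) • x) = f (op a • x) + f (op b • x)
    rw [MulOpposite.op_add, add_smul, map_add]
  zero_smul f := by ext x; change f (op (0 : B) • x) = 0; rw [op_zero, zero_smul, map_zero]

@[simp] lemma op_smul_apply {A : Type*} [Ring A] [Module A X] [SMulCommClass A K X] (a : Aᵐᵒᵖ)
    (f : KDual K X) (x : X) : (a • f) x = f (a.unop • x) := rfl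

@[simp] lemma smul_apply {B : Type*} [Ring B] [Module Bᵐᵒᵖ X] [SMulCommClass Bᵐᵒᵖ K X] (b : B)
    (f : KDual K X) (x : X) : (b • f) x = f (op b • x) := rfl

instance {A B : Type*} [Ring A] [Module A X] [SMulCommClass A K X] [Ring B] [Module Bᵐᵒᵖ X]
    [SMulCommClass Bᵐᵒᵖ K X] [SMulCommClass A Bᵐᵒᵖ X] : SMulCommClass B Aᵐᵒᵖ (KDual K X) where
  smul_comm b a f := by
    ext x
    simp [smul_comm]

instance {A : Type*} [Ring A] [Algebra K A] : Central K A (KDual K A) where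
  smul_eq k f := by
    ext x
    simp [Algebra.commutes]

end KDual

/-! ### Dominant dimension -/

/-- A minimal injective resolution `0 → M → I₀ → I₁ → ⋯` by finitely generated modules: it is
exact, all `Iₙ` are injective, and each of `M → I₀`, `Iₙ / ker dₙ → Iₙ₊₁` is an essential
embedding, i.e. only the zero submodule meets the image trivially. -/
structure MinInjRes (R M : Type u) [Ring R] [AddCommGroup M] [Module R M] where
  I : ℕ → FGModuleCat.{u} R
  ι : M →ₗ[R] I 0
  d : ∀ n, I n →ₗ[R] I (n + 1)
  injective : ∀ n, Module.Injective R (I n)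
  ι_injective : Function.Injective ι
  exact_zero : Function.Exact ι (d 0)
  exact_succ : ∀ n, Function.Exact (d n) (d (n + 1))
  ι_essential : ∀ N : Submodule R (I 0), N ⊓ LinearMap.range ι = ⊥ → N = ⊥
  d_essential : ∀ n, ∀ N : Submodule R (I (n + 1)), N ⊓ LinearMap.range (d n) = ⊥ → N = ⊥

/-- The dominant dimension of a module: the supremum of all `n` such that the first `n` terms
`I₀, …, Iₙ₋₁` of a minimal injective resolution are projective. -/
noncomputable def domDim (R M : Type u) [Ring R] [AddCommGroup M] [Module R M] : ℕ∞ :=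
  sSup {m : ℕ∞ | ∃ n : ℕ, m = n ∧ ∃ 𝓘 : MinInjRes R M, ∀ i < n, Module.Projective R (𝓘.I i)}

/-! ### The modules `Ae`, `eA` and the algebra `eAe` -/

/-- The left ideal `Ae` for an idempotent `e`. -/
def AE {A : Type*} [Ring A] (e : A) : Submodule A A where
  carrier := {x | x * e = x}
  add_mem' {x y} hx hy := by
    change (x + y) * e = x + y
    rw [add_mul, show x * e = x from hx, show y * e = y from hy]
  zero_mem' := zero_mul e
  smul_mem' a x hx := by
    change a * x * e = a * x
    rw [mul_assoc, show x * e = x from hx]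

/-- The right ideal `eA` for an idempotent `e`. -/
def EA {A : Type*} [Ring A] (e : A) : Submodule Aᵐᵒᵖ A where
  carrier := {x | e * x = x}
  add_mem' {x y} hx hy := by
    change e * (x + y) = x + y
    rw [mul_add, show e * x = x from hx, show e * y = y from hy]
  zero_mem' := mul_zero e
  smul_mem' a x hx := by
    change e * (x * a.unop) = x * a.unop
    rw [← mul_assoc, show e * x = x from hx]

section Corner

variable {A : Type*} [Ring A] {e : A}

lemma corner_left (he : IsIdempotentElem e) (c : he.Corner) : e * c.1 = c.1 :=
  ((Subsemigroup.mem_corner_iff he).mp c.2).1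

lemma corner_right (he : IsIdempotentElem e) (c : he.Corner) : c.1 * e = c.1 :=
  ((Subsemigroup.mem_corner_iff he).mp c.2).2

lemma AE.mul_e (x : AE e) : x.1 * e = x.1 := x.2

lemma EA.e_mul (x : EA e) : e * x.1 = x.1 := x.2

/-- `Ae` is a right `eAe`-module by multiplication. -/
instance (he : IsIdempotentElem e) : Module (he.Corner)ᵐᵒᵖ (AE e) where
  smul c x := ⟨x.1 * c.unop.1, by
    change x.1 * c.unop.1 * e = x.1 * c.unop.1
    rw [mul_assoc, corner_right]⟩
  one_smul x := Subtype.ext x.2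
  mul_smul c d x := Subtype.ext (mul_assoc x.1 d.unop.1 c.unop.1).symm
  smul_zero c := Subtype.ext (zero_mul _)
  smul_add c x y := Subtype.ext (add_mul x.1 y.1 _)
  add_smul c d x := Subtype.ext (mul_add x.1 c.unop.1 d.unop.1)
  zero_smul x := Subtype.ext (mul_zero x.1)

/-- `eA` is a left `eAe`-module by multiplication. -/
instance (he : IsIdempotentElem e) : Module he.Corner (EA e) where
  smul c x := ⟨c.1 * x.1, by
    change e * (c.1 * x.1) = c.1 * x.1
    rw [← mul_assoc, corner_left]⟩
  one_smul x := Subtype.ext x.2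
  mul_smul c d x := Subtype.ext (mul_assoc c.1 d.1 x.1)
  smul_zero c := Subtype.ext (mul_zero _)
  smul_add c x y := Subtype.ext (mul_add _ x.1 y.1)
  add_smul c d x := Subtype.ext (add_mul c.1 d.1 x.1)
  zero_smul x := Subtype.ext (zero_mul x.1)

lemma AE.coe_op_smul (he : IsIdempotentElem e) (c : (he.Corner)ᵐᵒᵖ) (x : AE e) :
    (c • x : AE e).1 = x.1 * c.unop.1 := rfl

lemma EA.coe_smul (he : IsIdempotentElem e) (c : he.Corner) (x : EA e) :
    (c • x : EA e).1 = c.1 * x.1 := rfl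

instance (he : IsIdempotentElem e) : SMulCommClass A (he.Corner)ᵐᵒᵖ (AE e) where
  smul_comm a c x := Subtype.ext (mul_assoc a x.1 c.unop.1).symm

instance (he : IsIdempotentElem e) : SMulCommClass he.Corner Aᵐᵒᵖ (EA e) where
  smul_comm c a x := Subtype.ext (mul_assoc c.1 x.1 a.unop).symm

instance {K : Type*} [Field K] [Algebra K A] (he : IsIdempotentElem e) :
    SMulCommClass (he.Corner)ᵐᵒᵖ K (AE e) where
  smul_comm c k x := Subtype.ext (smul_mul_assoc k x.1 c.unop.1)

/-- `eAe` is a `K`-algebra. -/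
instance {K : Type*} [Field K] [Algebra K A] (he : IsIdempotentElem e) :
    Algebra K he.Corner :=
  letI : Module K he.Corner :=
    { smul := fun k c => ⟨k • c.1, k • c.1, by
        change e * (k • c.1) * e = k • c.1
        rw [mul_smul_comm, corner_left he, smul_mul_assoc, corner_right he]⟩
      one_smul := fun c => Subtype.ext (one_smul K c.1)
      mul_smul := fun k k' c => Subtype.ext (mul_smul k k' c.1)
      smul_zero := fun k => Subtype.ext (smul_zero k)
      smul_add := fun k c d => Subtype.ext (smul_add k c.1 d.1)
      add_smul := fun k k' c => Subtype.ext (add_smul k k' c.1)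
      zero_smul := fun c => Subtype.ext (zero_smul K c.1) }
  Algebra.ofModule (fun k c d => Subtype.ext (smul_mul_assoc k c.1 d.1))
    (fun k c d => Subtype.ext (mul_smul_comm k c.1 d.1))

/-- The element `e` of `Ae`. -/
def eAE (he : IsIdempotentElem e) : AE e := ⟨e, he⟩

/-- The element `e` of `eA`. -/
def eEA (he : IsIdempotentElem e) : EA e := ⟨e, he⟩

/-- The `A`-bimodule `Ae ⊗_{eAe} eA`. -/
abbrev AeeA (he : IsIdempotentElem e) : Type _ := BTensor he.Corner (AE e) (EA e)

/-- The multiplication map `Ae ⊗_{eAe} eA → A`, `ae ⊗ eb ↦ aeb`. -/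
def mulMap (he : IsIdempotentElem e) : BimodHom A A (AeeA he) A where
  toAddMonoidHom := lift (fun x y => x.1 * y.1)
    (fun x x' y => add_mul x.1 x'.1 y.1) (fun x y y' => mul_add x.1 y.1 y'.1)
    (fun x c y => mul_assoc x.1 c.1 y.1)
  map_left a t := by
    change lift _ _ _ _ (a • t) = a • lift _ _ _ _ t
    induction t using induction_on with
    | zero => simp
    | tmul x y => exact mul_assoc a x.1 y.1
    | add s t hs ht => rw [smul_add, map_add, map_add, smul_add, hs, ht]
  map_right a t := by
    change lift _ _ _ _ (op a • t) = op a • lift _ _ _ _ t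
    induction t using induction_on with
    | zero => simp
    | tmul x y => exact (mul_assoc x.1 y.1 a).symm
    | add s t hs ht => rw [smul_add, map_add, map_add, smul_add, hs, ht]

@[simp] lemma mulMap_tmul (he : IsIdempotentElem e) (x : AE e) (y : EA e) :
    mulMap he (tmul he.Corner x y) = x.1 * y.1 := rfl

/-- The comultiplication `ae ⊗ eb ↦ (ae ⊗ e) ⊗ (e ⊗ eb)` of `Ae ⊗_{eAe} eA`. -/
def canComul (he : IsIdempotentElem e) :
    BimodHom A A (AeeA he) (BTensor A (AeeA he) (AeeA he)) where
  toAddMonoidHom := lift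
    (fun x y => tmul A (tmul he.Corner x (eEA he)) (tmul he.Corner (eAE he) y))
    (fun x x' y => by rw [add_tmul, add_tmul]) (fun x y y' => by rw [tmul_add, tmul_add])
    (fun x c y => by
      change tmul A (tmul he.Corner (op c • x) (eEA he)) (tmul he.Corner (eAE he) y) =
        tmul A (tmul he.Corner x (eEA he)) (tmul he.Corner (eAE he) (c • y))
      have h1 : (c • eEA he : EA e) = op c.1 • eEA he :=
        Subtype.ext ((corner_right he c).trans (corner_left he c).symm)
      have h2 : (op c • eAE he : AE e) = c.1 • eAE he :=
        Subtype.ext ((corner_left he c).trans (corner_right he c).symm)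
      rw [op_smul_tmul, h1, ← op_smul_tmul', op_smul_tmul, smul_tmul, ← h2, op_smul_tmul])
  map_left a t := by
    change lift _ _ _ _ (a • t) = a • lift _ _ _ _ t
    induction t using induction_on with
    | zero => simp
    | tmul x y => rfl
    | add s t hs ht => rw [smul_add, map_add, map_add, smul_add, hs, ht]
  map_right a t := by
    change lift _ _ _ _ (op a • t) = op a • lift _ _ _ _ t
    induction t using induction_on with
    | zero => simp
    | tmul x y => rfl
    | add s t hs ht => rw [smul_add, map_add, map_add, smul_add, hs, ht]

@[simp] lemma canComul_tmul (he : IsIdempotentElem e) (x : AE e) (y : EA e) :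
    canComul he (tmul he.Corner x y) =
      tmul A (tmul he.Corner x (eEA he)) (tmul he.Corner (eAE he) y) := rfl

/-- The bocs `(A, Ae ⊗_{eAe} eA)`. -/
def canBocs (he : IsIdempotentElem e) : Bocs A (AeeA he) where
  comul := canComul he
  counit := mulMap he
  map_id_counit t := by
    induction t using induction_on with
    | zero =>
      rw [zero_tmul]
      exact (congrArg _ (canComul he).map_zero').trans (map_zero _)
    | tmul x y =>
      rw [canComul_tmul, tmap_tmul]
      change tmul A (tmul he.Corner x (eEA he)) (e * y.1) = _
      rw [show e * y.1 = y.1 • (1 : A) by rw [EA.e_mul, smul_eq_mul, mul_one],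
        ← op_smul_tmul, op_smul_tmul']
      congr 2
      exact Subtype.ext (EA.e_mul y)
    | add s t hs ht =>
      rw [show canComul he (s + t) = canComul he s + canComul he t from
        (canComul he).map_add' s t, map_add, hs, ht, add_tmul]
  map_counit_id t := by
    induction t using induction_on with
    | zero =>
      rw [tmul_zero]
      exact (congrArg _ (canComul he).map_zero').trans (map_zero _)
    | tmul x y =>
      rw [canComul_tmul, tmap_tmul]
      change tmul A (x.1 * e) (tmul he.Corner (eAE he) y) = _
      rw [show x.1 * e = op x.1 • (1 : A) by rw [AE.mul_e, op_smul_eq_mul, one_mul],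
        op_smul_tmul, smul_tmul]
      congr 2
      exact Subtype.ext (AE.mul_e x)
    | add s t hs ht =>
      rw [show canComul he (s + t) = canComul he s + canComul he t from
        (canComul he).map_add' s t, map_add, hs, ht, tmul_add]
  coassoc t := by
    induction t using induction_on with
    | zero =>
      have h1 : canComul he 0 = 0 := (canComul he).map_zero'
      rw [h1, map_zero, map_zero, map_zero]
    | tmul x y => rfl
    | add s t hs ht =>
      rw [show canComul he (s + t) = canComul he s + canComul he t from
        (canComul he).map_add' s t, map_add, map_add, map_add, hs, ht]

end Corner

/-- Transport of a bocs structure on `V` along an isomorphism `Θ : W ≅ V` of bimodules: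
`μ_W = (Θ⁻¹ ⊗ Θ⁻¹) μ_V Θ` and `ε_W = ε_V Θ`. -/
def Bocs.transport {A W V : Type*} [Ring A] [AddCommGroup W] [Module A W] [Module Aᵐᵒᵖ W]
    [SMulCommClass A Aᵐᵒᵖ W] [AddCommGroup V] [Module A V] [Module Aᵐᵒᵖ V]
    [SMulCommClass A Aᵐᵒᵖ V] (β : Bocs A V) (Θ : BimodEquiv A A W V) : Bocs A W where
  comul :=
    { toAddMonoidHom :=
        (tmap Θ.inv.right Θ.inv.left).comp (β.comul.toAddMonoidHom.comp Θ.hom.toAddMonoidHom)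
      map_left := fun a w => by
        change tmap _ _ (β.comul (Θ.hom (a • w))) = a • tmap _ _ (β.comul (Θ.hom w))
        rw [show Θ.hom (a • w) = a • Θ.hom w from Θ.map_left a w,
          show β.comul (a • Θ.hom w) = a • β.comul (Θ.hom w) from β.comul.map_left _ _]
        generalize β.comul (Θ.hom w) = t
        induction t using induction_on with
        | zero => simp
        | tmul x y =>
          rw [smul_tmul, tmap_tmul, tmap_tmul, smul_tmul]
          congr 1
          exact Θ.inv.map_left a x
        | add s t hs ht => rw [smul_add, map_add, map_add, smul_add, hs, ht]
      map_right := fun a w => by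
        change tmap _ _ (β.comul (Θ.hom (op a • w))) = op a • tmap _ _ (β.comul (Θ.hom w))
        rw [show Θ.hom (op a • w) = op a • Θ.hom w from Θ.map_right a w,
          show β.comul (op a • Θ.hom w) = op a • β.comul (Θ.hom w) from β.comul.map_right _ _]
        generalize β.comul (Θ.hom w) = t
        induction t using induction_on with
        | zero => simp
        | tmul x y =>
          rw [op_smul_tmul', tmap_tmul, tmap_tmul, op_smul_tmul']
          congr 1
          exact Θ.inv.map_right a y
        | add s t hs ht => rw [smul_add, map_add, map_add, smul_add, hs, ht] }
  counit := β.counit.comp Θ.hom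
  map_id_counit w := by
    have key : ∀ t : BTensor A V V,
        tmap LinearMap.id (β.counit.comp Θ.hom).left (tmap Θ.inv.right Θ.inv.left t) =
          tmap Θ.inv.right LinearMap.id (tmap LinearMap.id β.counit.left t) := by
      intro t
      induction t using induction_on with
      | zero => simp
      | tmul x y =>
        change tmul A (Θ.inv x) (β.counit (Θ.hom (Θ.inv y))) = tmul A (Θ.inv x) (β.counit y)
        rw [Θ.hom_inv]
      | add s t hs ht => simp only [map_add, hs, ht]
    refine (key (β.comul (Θ.hom w))).trans ?_
    rw [β.map_id_counit, tmap_tmul]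
    exact congrArg (fun z => tmul A z (1 : A)) (Θ.inv_hom w)
  map_counit_id w := by
    have key : ∀ t : BTensor A V V,
        tmap (β.counit.comp Θ.hom).right LinearMap.id (tmap Θ.inv.right Θ.inv.left t) =
          tmap LinearMap.id Θ.inv.left (tmap β.counit.right LinearMap.id t) := by
      intro t
      induction t using induction_on with
      | zero => simp
      | tmul x y =>
        change tmul A (β.counit (Θ.hom (Θ.inv x))) (Θ.inv y) = tmul A (β.counit x) (Θ.inv y)
        rw [Θ.hom_inv]
      | add s t hs ht => simp only [map_add, hs, ht]
    refine (key (β.comul (Θ.hom w))).trans ?_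
    rw [β.map_counit_id, tmap_tmul]
    exact congrArg (fun z => tmul A (1 : A) z) (Θ.inv_hom w)
  coassoc w := by
    -- all three factors are carried over by `Θ⁻¹`
    let θ : BTensor A V V →+ BTensor A W W := tmap Θ.inv.right Θ.inv.left
    have hθl : ∀ (a : A) t, θ (a • t) = a • θ t := by
      intro a t
      induction t using induction_on with
      | zero => simp
      | tmul x y => exact congrArg (fun z => tmul A z (Θ.inv y)) (Θ.inv.map_left a x)
      | add s t hs ht => rw [smul_add, map_add, map_add, smul_add, hs, ht]
    have hθr : ∀ (a : Aᵐᵒᵖ) t, θ (a • t) = a • θ t := by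
      intro a t
      induction t using induction_on with
      | zero => simp
      | tmul x y => exact congrArg (fun z => tmul A (Θ.inv x) z) (Θ.inv.map_right a.unop y)
      | add s t hs ht => rw [smul_add, map_add, map_add, smul_add, hs, ht]
    let θl : BTensor A V V →ₗ[A] BTensor A W W := ⟨θ.toAddHom, hθl⟩
    let θr : BTensor A V V →ₗ[Aᵐᵒᵖ] BTensor A W W := ⟨θ.toAddHom, hθr⟩
    have h0 : ∀ t : BTensor A (BTensor A V V) V,
        assoc (tmap θr Θ.inv.left t) = tmap Θ.inv.right θl (assoc t) := by
      intro t
      induction t using induction_on with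
      | zero => simp
      | tmul x z =>
        induction x using induction_on with
        | zero =>
          simp
        | tmul x y => rfl
        | add s t hs ht => rw [add_tmul, map_add, map_add, map_add, map_add, hs, ht]
      | add s t hs ht => rw [map_add, map_add, map_add, map_add, hs, ht]
    have h1 : ∀ (c : W →ₗ[Aᵐᵒᵖ] BTensor A W W), (∀ v, c v = θ (β.comul (Θ.hom v))) →
        ∀ t : BTensor A V V, tmap c LinearMap.id (θ t) =
          tmap θr Θ.inv.left (tmap β.comul.right LinearMap.id t) := by
      intro c hc t
      induction t using induction_on with
      | zero => simp
      | tmul x y =>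
        change tmul A (c (Θ.inv x)) (Θ.inv y) = tmul A (θ (β.comul x)) (Θ.inv y)
        rw [hc, Θ.hom_inv]
      | add s t hs ht => rw [map_add, map_add, hs, ht, map_add, map_add]
    have h2 : ∀ (c : W →ₗ[A] BTensor A W W), (∀ v, c v = θ (β.comul (Θ.hom v))) →
        ∀ t : BTensor A V V, tmap LinearMap.id c (θ t) =
          tmap Θ.inv.right θl (tmap LinearMap.id β.comul.left t) := by
      intro c hc t
      induction t using induction_on with
      | zero => simp
      | tmul x y =>
        change tmul A (Θ.inv x) (c (Θ.inv y)) = tmul A (Θ.inv x) (θ (β.comul y))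
        rw [hc, Θ.hom_inv]
      | add s t hs ht => rw [map_add, map_add, hs, ht, map_add, map_add]
    refine (congrArg assoc (h1 _ (fun v => rfl) (β.comul (Θ.hom w)))).trans ?_
    refine Eq.trans ?_ (h2 _ (fun v => rfl) (β.comul (Θ.hom w))).symm
    rw [h0, β.coassoc]

/-! ### Gendo-symmetric algebras -/

/-- `eA` is a minimal faithful projective-injective right `A`-module: it is faithful, projective
and injective, and no proper direct summand of it is faithful. -/
structure IsMinFaithfulProjInj {A : Type*} [Ring A] (e : A) : Prop where
  faithful : FaithfulSMul Aᵐᵒᵖ (EA e)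
  projective : Module.Projective Aᵐᵒᵖ (EA e)
  injective : Module.Injective Aᵐᵒᵖ (EA e)
  minimal : ∀ N N' : Submodule Aᵐᵒᵖ (EA e), IsCompl N N' → FaithfulSMul Aᵐᵒᵖ N → N = ⊤

/-- The `K`-algebra `A` is gendo-symmetric with minimal faithful projective-injective right module
`eA`: it has dominant dimension at least two and `D(Ae) ≅ eA` as `(eAe, A)`-bimodules. -/
structure IsGendoSymmetric (K : Type*) {A : Type*} [Field K] [Ring A] [Algebra K A] {e : A}
    (he : IsIdempotentElem e) : Prop where
  minFaithful : IsMinFaithfulProjInj e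
  two_le_domDim : 2 ≤ domDim Aᵐᵒᵖ A
  dual : Nonempty (BimodEquiv he.Corner A (KDual K (AE e)) (EA e))

section Phi

variable {K A : Type u} [Field K] [Ring A] [Algebra K A] {e : A} (he : IsIdempotentElem e)

/-- The bocs `(A, D(A))`, where `D(A)` is identified with `Ae ⊗_{eAe} eA` by means of `Θ`. -/
def bocsDA (Θ : BimodEquiv A A (KDual K A) (AeeA he)) : Bocs A (KDual K A) :=
  (canBocs he).transport Θ

/-- `I_M : M → Hom_A(D(A), M)`, `I_M(m)(ae ⊗ eb) = m a e b`, where `D(A)` is identified with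
`Ae ⊗_{eAe} eA` by means of `Θ`. -/
def IMap (Θ : BimodEquiv A A (KDual K A) (AeeA he)) (M : Type*) [AddCommGroup M]
    [Module Aᵐᵒᵖ M] : M →ₗ[Aᵐᵒᵖ] RHom A (KDual K A) M where
  toFun m := (LinearMap.mk ⟨fun w => op (mulMap he (Θ.hom w)) • m, fun x y => by
      rw [show Θ.hom (x + y) = Θ.hom x + Θ.hom y from Θ.map_add' x y,
        show ∀ s t, mulMap he (s + t) = mulMap he s + mulMap he t from (mulMap he).map_add',
        MulOpposite.op_add, add_smul]⟩
    (fun r w => by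
      change op (mulMap he (Θ.hom (r • w))) • m = r • op (mulMap he (Θ.hom w)) • m
      rw [show Θ.hom (r • w) = r • Θ.hom w from Θ.map_right r.unop w,
        show ∀ t, mulMap he (r • t) = r • mulMap he t from (mulMap he).map_right r.unop,
        ← mul_smul]
      rfl) : KDual K A →ₗ[Aᵐᵒᵖ] M)
  map_add' x y := RHom.ext fun w => smul_add _ x y
  map_smul' a m := RHom.ext fun w => by
    change op (mulMap he (Θ.hom w)) • a • m = op (mulMap he (Θ.hom (a.unop • w))) • m
    rw [show Θ.hom (a.unop • w) = a.unop • Θ.hom w from Θ.map_left a.unop w,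
      show ∀ t, mulMap he (a.unop • t) = a.unop • mulMap he t from (mulMap he).map_left a.unop,
      ← mul_smul]
    rfl

/-- The assignment `φ : mod-A → 𝓑-mod`, `φ(M) = M` and `φ(f) = I_N f` for `f : M → N`. -/
def phi (Θ : BimodEquiv A A (KDual K A) (AeeA he)) :
    FGModuleCat.{u} Aᵐᵒᵖ ⥤q BocsMod (bocsDA he Θ) where
  obj M := ⟨M⟩
  map {_ N} f := (IMap he Θ N).comp f.hom.hom

variable (A) in
/-- The full subcategory `Dom₂` of `mod-A`. -/
def Dom2 : ObjectProperty (FGModuleCat.{u} Aᵐᵒᵖ) := fun M => 2 ≤ domDim Aᵐᵒᵖ M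

/-- The full subcategory `Dom₂^𝓑` of `𝓑-mod`. -/
def Dom2B (Θ : BimodEquiv A A (KDual K A) (AeeA he)) :
    ObjectProperty (BocsMod (bocsDA he Θ)) := fun M => 2 ≤ domDim Aᵐᵒᵖ M.toMod

end Phi

section Nakayama

variable (K : Type u) {A : Type u} [Field K] [Ring A] [Algebra K A]

lemma finite_RHom [FiniteDimensional K A] (M : FGModuleCat.{u} Aᵐᵒᵖ) :
    Module.Finite Aᵐᵒᵖ (RHom A (KDual K A) M) := by
  let _ : Module K M := Module.compHom M (algebraMap K Aᵐᵒᵖ)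
  have : IsScalarTower K Aᵐᵒᵖ M := ⟨fun k a m => by
    rw [Algebra.smul_def, mul_smul]; rfl⟩
  have : Module.Finite K M := Module.Finite.trans Aᵐᵒᵖ M
  let _ : Module K (RHom A (KDual K A) M) := Module.compHom _ (algebraMap K Aᵐᵒᵖ)
  have : IsScalarTower K Aᵐᵒᵖ (RHom A (KDual K A) M) := ⟨fun k a m => by
    rw [Algebra.smul_def, mul_smul]; rfl⟩
  let j : RHom A (KDual K A) M →ₗ[K] ((A →ₗ[K] K) →ₗ[K] M) :=
    { toFun := fun h =>
        { toFun := fun w => h w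
          map_add' := fun x y => map_add h x y
          map_smul' := fun k w => by
            change h (k • w : A →ₗ[K] K) = op (algebraMap K A k) • h w
            refine Eq.trans (congrArg h (KDual.ext fun x => ?_))
              (map_smul h (op (algebraMap K A k)) (show KDual K A from w))
            change k • w x = w (algebraMap K A k * x)
            rw [← map_smul w k x, Algebra.smul_def] }
      map_add' := fun _ _ => rfl
      map_smul' := fun k h => LinearMap.ext fun w => by
        change h (algebraMap K A k • (show KDual K A from w)) =
          op (algebraMap K A k) • h (show KDual K A from w)
        rw [Central.smul_eq, map_smul] }
  have hj : Function.Injective j := fun f g hfg =>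
    RHom.ext fun w => LinearMap.congr_fun hfg w
  have : Module.Finite K (RHom A (KDual K A) M) := Module.Finite.of_injective j hj
  exact Module.Finite.of_restrictScalars_finite K Aᵐᵒᵖ _

/-- The inverse Nakayama functor on objects: `ν⁻¹(M) = Hom_A(D(A), M)`. -/
def nuInv [FiniteDimensional K A] (M : FGModuleCat.{u} Aᵐᵒᵖ) : FGModuleCat.{u} Aᵐᵒᵖ :=
  have := finite_RHom K M
  FGModuleCat.of Aᵐᵒᵖ (RHom A (KDual K A) M)

end Nakayama

end Gendo

namespace Gendo

open BTensor

/-! ### Injective hulls and minimal injective resolutions -/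

section Hulls

variable {R : Type u} [Ring R]

/-! Everything is controlled by restriction to `eAe`, that is by `M ↦ Me` and the canonical map `M →
Hom_{eAe}(Ae, Me)`. Call `M` torsionless if this map is injective and closed if it is bijective
(`IsTorsionless`, `IsCornerClosed`).

An isomorphism `D(Ae) ≅ eA` is a nondegenerate pairing of `eA` and `Ae`. It makes `eA` closed, lets
finitely generated torsionless modules embed into powers of `eA`, and together with faithfulness
makes `A` torsionless. Hence finitely generated projective-injective modules are closed, and a
finitely generated module has dominant dimension at least two exactly when it is closed
(`isCornerClosed_of_two_le_domDim`, `two_le_domDim_of_isCornerClosed`). In particular `A` is closed,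
so the functionals on `Ae ⊗ eA` are `Hom_{eAe}(Ae, D(eA)) = Hom_{eAe}(Ae, Ae) = A`, which gives
`D(A) ≅ Ae ⊗ eA`.

Consequently `Hom_A(D(A), M) = Hom_{eAe}(Ae, Me)`, with `I_M` as the canonical map. So `I_M` is
bijective for closed `M`, and `φ` is fully faithful on `Dom₂`. Evaluation at `e ⊗ e` identifies
`Hom_𝓑(M, N)` with `Hom_{eAe}(Me, Ne)` (`bocsRestrict_bijective`). Since `μ(e ⊗ e) = (e ⊗ e) ⊗ (e ⊗
e)`, this respects composition, and `M ↦ Me` is an equivalence from `𝓑-mod` to `mod-eAe`, dense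
because `(X ⊗ eA)e ≅ X`. Finally `I_M` is always bijective on `Me`, so `M ≅ ν⁻¹(M)` in `𝓑-mod`; as
`ν⁻¹(M)` is closed, `Dom₂` already reaches every object of `mod-eAe`. -/

lemma injective_of_retract {Q E : Type u} [AddCommGroup Q] [Module R Q] [AddCommGroup E]
    [Module R E] (hQ : Module.Injective R Q) (i : E →ₗ[R] Q) (r : Q →ₗ[R] E)
    (h : ∀ x, r (i x) = x) : Module.Injective R E where
  out X Y _ _ _ _ f hf g := by
    obtain ⟨k, hk⟩ := hQ.out f hf (i ∘ₗ g)
    exact ⟨r ∘ₗ k, fun x => by simp [hk, h]⟩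

/-- By hypothesis the kernel of `f` meets the image of `j` trivially, so essentiality makes it zero.
-/
lemma injective_of_essential {M E Q : Type*} [AddCommGroup M] [Module R M] [AddCommGroup E]
    [Module R E] [AddCommGroup Q] [Module R Q] {j : M →ₗ[R] E}
    (hj : ∀ N : Submodule R E, N ⊓ LinearMap.range j = ⊥ → N = ⊥) (f : E →ₗ[R] Q)
    (hf : ∀ m, f (j m) = 0 → j m = 0) : Function.Injective f := by
  rw [← LinearMap.ker_eq_bot]
  refine hj _ (eq_bot_iff.2 ?_)
  rintro _ ⟨hx, m, rfl⟩
  exact hf m hx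

lemma exists_retraction {E Q : Type u} [AddCommGroup E] [Module R E] [AddCommGroup Q] [Module R Q]
    (hE : Module.Injective R E) (i : E →ₗ[R] Q) (hi : Function.Injective i) :
    ∃ r : Q →ₗ[R] E, ∀ x, r (i x) = x :=
  hE.out i hi LinearMap.id

variable (R) in
/-- Every finitely generated module embeds into a finitely generated injective module. -/
def EnoughInjectives : Prop :=
  ∀ M : FGModuleCat.{u} R, ∃ Q : FGModuleCat.{u} R, Module.Injective R Q ∧
    ∃ j : M →ₗ[R] Q, Function.Injective j

/-- The hull is a minimal injective submodule `E` of `Q` containing the image of `M`. If `N` misses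
`M`, then `M` embeds into `E / N`, which yields an endomorphism `v` of `E` fixing `M` and killing
`N`. By Fitting's lemma the image of a power of `v` is a direct summand containing `M`. By
minimality it is all of `E`, so that power is injective and `N = 0`. -/
lemma exists_essential_injective_submodule [IsNoetherianRing R] [IsArtinianRing R] {M Q : Type u}
    [AddCommGroup M] [Module R M] [AddCommGroup Q] [Module R Q] [Module.Finite R Q]
    (hQ : Module.Injective R Q) (j : M →ₗ[R] Q) (hj : Function.Injective j) :
    ∃ E : Submodule R Q, Module.Injective R E ∧ ∃ i : M →ₗ[R] E, Function.Injective i ∧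
      ∀ N : Submodule R E, N ⊓ LinearMap.range i = ⊥ → N = ⊥ := by
  obtain ⟨E, ⟨hME, hE⟩, hmin⟩ := IsArtinian.set_has_minimal (R := R)
    {E : Submodule R Q | LinearMap.range j ≤ E ∧ Module.Injective R E}
    ⟨⊤, le_top, injective_of_retract hQ (Submodule.subtype ⊤)
      (LinearMap.codRestrict ⊤ LinearMap.id fun _ => trivial) fun x => rfl⟩
  let i : M →ₗ[R] E := j.codRestrict E fun m => hME ⟨m, rfl⟩
  have hi : Function.Injective i := fun x y h => hj (congrArg Subtype.val h)
  refine ⟨E, hE, i, hi, fun N hN => ?_⟩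
  -- an endomorphism of `E` that fixes `M` and kills `N`
  obtain ⟨g, hg⟩ := hE.out (N.mkQ ∘ₗ i) (by
    rw [← LinearMap.ker_eq_bot, LinearMap.ker_eq_bot']
    intro m hm
    have h1 : i m ∈ N ⊓ LinearMap.range i := ⟨(Submodule.Quotient.mk_eq_zero _).1 hm, m, rfl⟩
    rw [hN, Submodule.mem_bot] at h1
    exact hi (h1.trans (map_zero i).symm)) i
  let v : Module.End R E := g ∘ₗ N.mkQ
  have hv : ∀ m, v (i m) = i m := hg
  -- The bound `n ≥ 1` ensures that `v ^ n` still kills `N`.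
  obtain ⟨n, hn1, hn⟩ := ((Filter.eventually_ge_atTop 1).and
    v.eventually_isCompl_ker_pow_range_pow).exists
  have hvn : ∀ m, (v ^ n) (i m) = i m := by
    intro m
    clear hn hn1
    induction n with
    | zero => rfl
    | succ n ih => rw [pow_succ, Module.End.mul_apply, hv, ih]
  have hrange : Module.Injective R (LinearMap.range (v ^ n)) :=
    injective_of_retract hE (Submodule.subtype _)
      (Submodule.projectionOnto _ _ hn.symm)
      fun x => Submodule.projectionOnto_apply_left _ x
  let E' := (LinearMap.range (v ^ n)).map E.subtype
  have hE' : Module.Injective R E' := by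
    let ψ := Submodule.equivMapOfInjective E.subtype E.injective_subtype (LinearMap.range (v ^ n))
    exact injective_of_retract hrange ψ.symm.toLinearMap ψ.toLinearMap ψ.apply_symm_apply
  have hnot := hmin E' ⟨by
    rintro _ ⟨m, rfl⟩
    exact ⟨i m, ⟨i m, hvn m⟩, rfl⟩, hE'⟩
  have hle : E ≤ E' := by
    have h2 : E' ≤ E := Submodule.map_subtype_le _ _
    by_contra hc
    exact hnot (lt_of_le_not_ge h2 hc)
  have htop : LinearMap.range (v ^ n) = ⊤ := by
    rw [eq_top_iff]
    rintro ⟨x, hx⟩ -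
    obtain ⟨y, hy, rfl⟩ := hle hx
    exact hy
  have hker : LinearMap.ker (v ^ n) = ⊥ := by
    have := hn.inf_eq_bot
    rwa [htop, inf_top_eq] at this
  refine eq_bot_iff.2 fun x hx => ?_
  rw [← hker, LinearMap.mem_ker]
  obtain ⟨k, rfl⟩ : ∃ k, n = k + 1 := ⟨n - 1, by omega⟩
  rw [pow_succ, Module.End.mul_apply, show v x = 0 by
    change g (N.mkQ x) = 0
    rw [Submodule.mkQ_apply, (Submodule.Quotient.mk_eq_zero N).2 hx, map_zero], map_zero]

lemma EnoughInjectives.exists_hull [IsNoetherianRing R] [IsArtinianRing R]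
    (hR : EnoughInjectives R) (M : FGModuleCat.{u} R) :
    ∃ E : FGModuleCat.{u} R, Module.Injective R E ∧ ∃ i : M →ₗ[R] E, Function.Injective i ∧
      ∀ N : Submodule R E, N ⊓ LinearMap.range i = ⊥ → N = ⊥ := by
  obtain ⟨Q, hQ, j, hj⟩ := hR M
  obtain ⟨E, h⟩ := exists_essential_injective_submodule hQ j hj
  exact ⟨FGModuleCat.of R E, h⟩

lemma EnoughInjectives.exists_minInjRes [IsNoetherianRing R] [IsArtinianRing R]
    (hR : EnoughInjectives R) (M : Type u) [AddCommGroup M] [Module R M] [Module.Finite R M] :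
    Nonempty (MinInjRes R M) := by
  choose E hE i hi hess using hR.exists_hull
  -- The recursion carries a whole map `X → Y`, because the next differential is `Y → Y / im →
  -- hull(Y / im)` and depends on it.
  let S := Σ X Y : FGModuleCat.{u} R, X →ₗ[R] Y
  let next : S → S := fun s =>
    let C := FGModuleCat.of R (s.2.1 ⧸ LinearMap.range s.2.2)
    ⟨s.2.1, E C, i C ∘ₗ (LinearMap.range s.2.2).mkQ⟩
  let s : ℕ → S := fun n =>
    Nat.rec ⟨FGModuleCat.of R M, E (FGModuleCat.of R M), i (FGModuleCat.of R M)⟩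
      (fun _ t => next t) n
  have hker : ∀ t : S, Function.Exact t.2.2 (next t).2.2 := by
    intro t x
    change i (FGModuleCat.of R (t.2.1 ⧸ LinearMap.range t.2.2)) ((LinearMap.range t.2.2).mkQ x) = 0
      ↔ _
    rw [map_eq_zero_iff _ (hi _), Submodule.mkQ_apply, Submodule.Quotient.mk_eq_zero]
    rfl
  have hrange : ∀ t : S, ∀ N : Submodule R (next t).2.1,
      N ⊓ LinearMap.range (next t).2.2 = ⊥ → N = ⊥ := by
    intro t N hN
    refine hess _ N ?_
    rwa [show LinearMap.range (next t).2.2 = LinearMap.range (i (FGModuleCat.of R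
      (t.2.1 ⧸ LinearMap.range t.2.2))) from LinearMap.range_comp_of_range_eq_top _
        (Submodule.range_mkQ _)] at hN
  exact ⟨{
    I := fun n => (s n).2.1
    ι := i (FGModuleCat.of R M)
    d := fun n => (s (n + 1)).2.2
    injective := fun n => by cases n <;> exact hE _
    ι_injective := hi _
    exact_zero := hker (s 0)
    exact_succ := fun n => hker (s (n + 1))
    ι_essential := hess _
    d_essential := fun n => hrange (s n) }⟩

lemma projective_of_injective_map {E P : Type u} [AddCommGroup E] [Module R E] [AddCommGroup P]
    [Module R P] (hE : Module.Injective R E) (hP : Module.Projective R P) (f : E →ₗ[R] P)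
    (hf : Function.Injective f) : Module.Projective R E := by
  obtain ⟨r, hr⟩ := exists_retraction hE f hf
  exact Module.Projective.of_split f r (LinearMap.ext hr)

/-- A module has dominant dimension at least two as soon as it is the kernel of a map between
finitely generated projective-injective modules. -/
lemma EnoughInjectives.two_le_domDim [IsNoetherianRing R] [IsArtinianRing R]
    (hR : EnoughInjectives R) {M P Q : Type u} [AddCommGroup M] [Module R M] [Module.Finite R M]
    [AddCommGroup P] [Module R P] [AddCommGroup Q] [Module R Q]
    (hP : Module.Projective R P) (hP' : Module.Injective R P)
    (hQ : Module.Projective R Q) (hQ' : Module.Injective R Q)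
    (a : M →ₗ[R] P) (ha : Function.Injective a) (b : P →ₗ[R] Q) (hab : Function.Exact a b) :
    2 ≤ domDim R M := by
  obtain ⟨𝓘⟩ := hR.exists_minInjRes M
  obtain ⟨g, hg⟩ := hP'.out 𝓘.ι 𝓘.ι_injective a
  have hginj : Function.Injective g := injective_of_essential 𝓘.ι_essential g fun m hm => by
    rw [hg] at hm
    rw [(map_eq_zero_iff a ha).1 hm, map_zero]
  have hker : ∀ x, b (g x) = 0 ↔ 𝓘.d 0 x = 0 := by
    intro x
    rw [hab (g x), 𝓘.exact_zero x]
    constructor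
    · rintro ⟨m, hm⟩
      exact ⟨m, hginj ((hg m).trans hm)⟩
    · rintro ⟨m, rfl⟩
      exact ⟨m, (hg m).symm⟩
  -- Both `d₀` and `b ∘ g` have the same kernel, so `b ∘ g` factors through `I₀ / ker d₀ ⊆ I₁` and
  -- extends to `I₁` by injectivity of `Q`.
  obtain ⟨h, hh⟩ : ∃ h : 𝓘.I 1 →ₗ[R] Q, ∀ x, h (𝓘.d 0 x) = b (g x) := by
    have hk : LinearMap.ker (𝓘.d 0) ≤ LinearMap.ker (b ∘ₗ g) := fun x hx => (hker x).2 hx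
    obtain ⟨h, hh⟩ := hQ'.out ((LinearMap.ker (𝓘.d 0)).liftQ (𝓘.d 0) le_rfl)
      (by rw [← LinearMap.ker_eq_bot]; exact Submodule.ker_liftQ_eq_bot _ _ _ le_rfl)
      ((LinearMap.ker (𝓘.d 0)).liftQ (b ∘ₗ g) hk)
    exact ⟨h, fun x => hh (Submodule.Quotient.mk x)⟩
  have hhinj : Function.Injective h := injective_of_essential (𝓘.d_essential 0) h fun x hx => by
    rwa [hh, hker] at hx
  refine le_sSup ⟨2, rfl, 𝓘, fun n hn => ?_⟩
  interval_cases n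
  · exact projective_of_injective_map (𝓘.injective 0) hP g hginj
  · exact projective_of_injective_map (𝓘.injective 1) hQ h hhinj

/-- Since `n - 1` lies strictly below the supremum, some `k > n - 1` belongs to the set, and its
resolution works for `n`. For `n = 0` the claim would assert that a resolution exists at all, hence
`0 < n`. -/
lemma exists_minInjRes_of_le_domDim {M : Type u} [AddCommGroup M] [Module R M] {n : ℕ} (hn : 0 < n)
    (h : n ≤ domDim R M) : ∃ 𝓘 : MinInjRes R M, ∀ i < n, Module.Projective R (𝓘.I i) := by
  obtain ⟨m, rfl⟩ : ∃ m, n = m + 1 := ⟨n - 1, by omega⟩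
  have hlt : (m : ℕ∞) < domDim R M := lt_of_lt_of_le (by exact_mod_cast Nat.lt_succ_self m) h
  obtain ⟨_, ⟨k, rfl, 𝓘, h𝓘⟩, hk⟩ := lt_sSup_iff.1 hlt
  have hk' : m < k := by exact_mod_cast hk
  exact ⟨𝓘, fun i hi => h𝓘 i (by omega)⟩

end Hulls

/-! ### Duality for right modules over a finite dimensional algebra -/

section Duality

variable {K A : Type u} [Field K] [Ring A] [Algebra K A]

/-- The map `M → D(X)`, `m ↦ (x ↦ f (m p(x)))`, for a functional `f` on a right module `M` and a
left linear map `p : X → A`. -/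
def toKDual {X M : Type*} [AddCommGroup X] [Module A X] [Module K X] [SMulCommClass A K X]
    [IsScalarTower K A X] [AddCommGroup M] [Module Aᵐᵒᵖ M] (p : X →ₗ[A] A) (f : M →+ K)
    (hf : ∀ (k : K) m, f (op (algebraMap K A k) • m) = k * f m) : M →ₗ[Aᵐᵒᵖ] KDual K X where
  toFun m := (LinearMap.mk ⟨fun x => f (op (p x) • m), fun x y => by
      rw [map_add, MulOpposite.op_add, add_smul, map_add]⟩
    (fun k x => by
      change f (op (p (k • x)) • m) = k * f (op (p x) • m)
      rw [← hf, ← mul_smul, ← op_mul, LinearMap.map_smul_of_tower, ← Algebra.commutes,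
        Algebra.smul_def]) : X →ₗ[K] K)
  map_add' m m' := KDual.ext fun x => by
    change f (op (p x) • (m + m')) = f (op (p x) • m) + f (op (p x) • m')
    rw [smul_add, map_add]
  map_smul' a m := KDual.ext fun x => by
    change f (op (p x) • a • m) = f (op (p (a.unop • x)) • m)
    rw [← mul_smul, p.map_smul]
    rfl

variable (K) in
/-- The `K`-vector space underlying a right `A`-module. -/
@[reducible] def rightVectorSpace (A M : Type*) [Ring A] [Algebra K A] [AddCommGroup M]
    [Module Aᵐᵒᵖ M] : Module K M :=
  Module.compHom M (algebraMap K Aᵐᵒᵖ)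

lemma rightVectorSpace_isScalarTower (A M : Type*) [Ring A] [Algebra K A] [AddCommGroup M]
    [Module Aᵐᵒᵖ M] :
    letI := rightVectorSpace K A M
    IsScalarTower K Aᵐᵒᵖ M :=
  letI := rightVectorSpace K A M
  ⟨fun k a m => by rw [Algebra.smul_def, mul_smul]; rfl⟩

lemma rightVectorSpace_finite (A M : Type*) [Ring A] [Algebra K A] [FiniteDimensional K A]
    [AddCommGroup M] [Module Aᵐᵒᵖ M] [Module.Finite Aᵐᵒᵖ M] :
    letI := rightVectorSpace K A M
    Module.Finite K M := by
  let _ := rightVectorSpace K A M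
  have := rightVectorSpace_isScalarTower (K := K) A M
  exact Module.Finite.trans Aᵐᵒᵖ M

variable (K) in
-- These are the coordinates for a `K`-basis of `M`. They are recorded as additive maps with
-- explicit homogeneity, so that the `K`-structure on `M` stays local to the proof.
lemma exists_separating_functionals [FiniteDimensional K A] (M : Type*) [AddCommGroup M]
    [Module Aᵐᵒᵖ M] [Module.Finite Aᵐᵒᵖ M] : ∃ (n : ℕ) (f : Fin n → M →+ K),
      (∀ i (k : K) m, f i (op (algebraMap K A k) • m) = k * f i m) ∧
      ∀ m, (∀ i, f i m = 0) → m = 0 := by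
  let _ := rightVectorSpace K A M
  have := rightVectorSpace_finite (K := K) A M
  let b := Module.finBasis K M
  refine ⟨_, fun i => (b.coord i).toAddMonoidHom, fun i k m => (b.coord i).map_smul k m,
    fun m hm => b.forall_coord_eq_zero_iff.1 hm⟩

/-- Maps `X → D(A)` correspond to functionals on `X` through evaluation at `1`, and functionals
extend along injections of vector spaces. -/
instance injective_kDual : Module.Injective Aᵐᵒᵖ (KDual K A) where
  out X Y _ _ _ _ f hf g := by
    let _ := rightVectorSpace K A X
    let _ := rightVectorSpace K A Y
    let f' : X →ₗ[K] Y :=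
      { toFun := f, map_add' := map_add f, map_smul' := fun k x => map_smul f _ x }
    obtain ⟨r, hr⟩ := f'.exists_leftInverse_of_injective (LinearMap.ker_eq_bot.2 hf)
    let g' : X →ₗ[K] K :=
      { toFun := fun x => g x (1 : A)
        map_add' := fun x y => by rw [map_add]; rfl
        map_smul' := fun k x => by
          change g (op (algebraMap K A k) • x) (1 : A) = k • g x (1 : A)
          rw [map_smul, KDual.op_smul_apply, ← map_smul (g x), unop_op, smul_eq_mul,
            Algebra.smul_def] }
    refine ⟨toKDual LinearMap.id (g' ∘ₗ r).toAddMonoidHom fun k y => (g' ∘ₗ r).map_smul k y,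
      fun x => KDual.ext fun a => ?_⟩
    change g' (r (op a • f' x)) = g x a
    have h1 : op a • f' x = f' (op a • x) := (map_smul f (op a) x).symm
    have h2 : ∀ z, r (f' z) = z := fun z => LinearMap.congr_fun hr z
    rw [h1, h2]
    change g (op a • x) (1 : A) = _
    rw [map_smul, KDual.op_smul_apply]
    exact congrArg (g x) (mul_one a)

instance finite_kDual [FiniteDimensional K A] : Module.Finite Aᵐᵒᵖ (KDual K A) := by
  let _ : Module K (KDual K A) := inferInstanceAs (Module K (A →ₗ[K] K))
  have : Module.Finite K (KDual K A) := inferInstanceAs (Module.Finite K (A →ₗ[K] K))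
  have : IsScalarTower K Aᵐᵒᵖ (KDual K A) := ⟨fun k a f => KDual.ext fun x => by
    change f ((k • a.unop) * x) = k • f (a.unop * x)
    rw [← map_smul, smul_mul_assoc]⟩
  exact Module.Finite.of_restrictScalars_finite K Aᵐᵒᵖ _

variable (K A) in
-- Finitely many functionals separating the points of `M` give an embedding into a finite power of
-- `D(A)`.
lemma enoughInjectives_op [FiniteDimensional K A] : EnoughInjectives.{u} Aᵐᵒᵖ := by
  intro M
  obtain ⟨n, f, hf, hsep⟩ := exists_separating_functionals K (A := A) M
  refine ⟨FGModuleCat.of Aᵐᵒᵖ (Fin n → KDual K A),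
    inferInstanceAs (Module.Injective Aᵐᵒᵖ (Fin n → KDual K A)),
    LinearMap.pi fun i => toKDual LinearMap.id (f i) (hf i), ?_⟩
  rw [← LinearMap.ker_eq_bot, LinearMap.ker_eq_bot']
  intro m hm
  refine hsep m fun i => ?_
  have h := DFunLike.congr_fun (congrFun hm i) (1 : A)
  change f i (op (1 : A) • m) = 0 at h
  rwa [op_one, one_smul] at h

end Duality

/-! ### Modules determined by their restriction to `eAe` -/

section Closed

variable {A : Type*} [Ring A] {e : A}

/-- No nonzero element of `M` is annihilated by `Ae`. -/
def IsTorsionless (e : A) (M : Type*) [AddCommGroup M] [Module Aᵐᵒᵖ M] : Prop :=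
  ∀ m : M, (∀ x : AE e, op x.1 • m = 0) → m = 0

/-- The canonical map `M → Hom_{eAe}(Ae, Me)` is bijective. -/
def IsCornerClosed (he : IsIdempotentElem e) (M : Type*) [AddCommGroup M] [Module Aᵐᵒᵖ M] : Prop :=
  ∀ h : AE e →+ M, (∀ (c : he.Corner) x, h (op c • x) = op c.1 • h x) →
    ∃! m : M, ∀ x : AE e, h x = op x.1 • m

variable {M P Q : Type*} [AddCommGroup M] [Module Aᵐᵒᵖ M] [AddCommGroup P] [Module Aᵐᵒᵖ P]
    [AddCommGroup Q] [Module Aᵐᵒᵖ Q]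

lemma IsTorsionless.of_injective (hP : IsTorsionless e P) (f : M →ₗ[Aᵐᵒᵖ] P)
    (hf : Function.Injective f) : IsTorsionless e M := by
  intro m hm
  rw [← map_eq_zero_iff f hf]
  exact hP _ fun x => by rw [← map_smul, hm, map_zero]

lemma IsTorsionless.pi {ι : Type*} {P : ι → Type*} [∀ i, AddCommGroup (P i)]
    [∀ i, Module Aᵐᵒᵖ (P i)] (h : ∀ i, IsTorsionless e (P i)) : IsTorsionless e (∀ i, P i) :=
  fun _ hm => funext fun i => h i _ fun x => congrFun (hm x) i

/-- A projective module embeds into a free one, where the condition can be tested on coordinates in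
`A`. -/
lemma IsTorsionless.of_projective (hA : IsTorsionless e A) (hM : Module.Projective Aᵐᵒᵖ M) :
    IsTorsionless e M := by
  obtain ⟨s, hs⟩ := (Module.projective_def'.1 hM)
  intro m hm
  have h0 : s m = 0 := by
    ext i
    refine unop_injective (hA _ fun x => ?_)
    have h := DFunLike.congr_fun ((map_smul s (op x.1) m).symm.trans ((congrArg s (hm x)).trans
      (map_zero s))) i
    exact congrArg unop h
  rw [← LinearMap.id_apply (R := Aᵐᵒᵖ) m, ← hs, LinearMap.comp_apply, h0, map_zero]

variable {he : IsIdempotentElem e}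

lemma IsCornerClosed.isTorsionless (hM : IsCornerClosed he M) : IsTorsionless e M := by
  intro m hm
  exact (hM 0 (fun c x => (smul_zero _).symm)).unique (fun x => (hm x).symm)
    fun x => (smul_zero _).symm

lemma isCornerClosed_of_exists (hM : IsTorsionless e M)
    (h : ∀ h : AE e →+ M, (∀ (c : he.Corner) x, h (op c • x) = op c.1 • h x) →
      ∃ m : M, ∀ x : AE e, h x = op x.1 • m) : IsCornerClosed he M := by
  intro f hf
  obtain ⟨m, hm⟩ := h f hf
  refine ⟨m, hm, fun m' hm' => sub_eq_zero.1 (hM _ fun x => ?_)⟩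
  rw [smul_sub, ← hm, ← hm', sub_self]

/-- The kernel of a map from a closed module to a torsionless module is closed. -/
lemma IsCornerClosed.of_exact (hP : IsCornerClosed he P) (hQ : IsTorsionless e Q)
    (a : M →ₗ[Aᵐᵒᵖ] P) (ha : Function.Injective a) (b : P →ₗ[Aᵐᵒᵖ] Q)
    (hab : Function.Exact a b) : IsCornerClosed he M := by
  refine isCornerClosed_of_exists (hP.isTorsionless.of_injective a ha) fun h hh => ?_
  obtain ⟨p, hp, -⟩ := hP (a.toAddMonoidHom.comp h) fun c x => by
    change a (h (op c • x)) = op c.1 • a (h x)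
    rw [hh, map_smul]
  have hbp : b p = 0 := hQ _ fun x => by
    rw [← map_smul, ← hp]
    exact hab.apply_apply_eq_zero (h x)
  obtain ⟨m, rfl⟩ := (hab p).1 hbp
  refine ⟨m, fun x => ha ?_⟩
  rw [map_smul]
  exact hp x

/-- A retract of `P` is the kernel of `1 - i r` on `P`. -/
lemma IsCornerClosed.of_retract (hP : IsCornerClosed he P) (i : M →ₗ[Aᵐᵒᵖ] P) (r : P →ₗ[Aᵐᵒᵖ] M)
    (hr : ∀ m, r (i m) = m) : IsCornerClosed he M :=
  hP.of_exact hP.isTorsionless i (Function.LeftInverse.injective hr) (LinearMap.id - i ∘ₗ r)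
    fun p => ⟨fun hp => ⟨r p, (sub_eq_zero.1 hp).symm⟩, by rintro ⟨m, rfl⟩; simp [hr]⟩

lemma IsCornerClosed.pi {ι : Type*} {P : ι → Type*} [∀ i, AddCommGroup (P i)]
    [∀ i, Module Aᵐᵒᵖ (P i)] (h : ∀ i, IsCornerClosed he (P i)) :
    IsCornerClosed he (∀ i, P i) := by
  refine isCornerClosed_of_exists (IsTorsionless.pi fun i => (h i).isTorsionless) fun f hf => ?_
  have hex : ∀ i, ∃ m : P i, ∀ x : AE e, f x i = op x.1 • m := fun i =>
    (h i ((Pi.evalAddMonoidHom P i).comp f) fun c x => congrFun (hf c x) i).exists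
  choose m hm using hex
  exact ⟨m, fun x => funext fun i => hm i x⟩

/-- If `v Ae ⊆ M`, then `x ↦ v x` is an `eAe`-linear map `Ae → M`, hence given by some `m` in `M`.
Then `Ae` kills `v - m` in the torsionless module `P`, so `v = m`. This allows a closed module to be
copresented by two powers of `eA`. -/
lemma IsCornerClosed.isTorsionless_quotient (hM : IsCornerClosed he M) (hP : IsTorsionless e P)
    (j : M →ₗ[Aᵐᵒᵖ] P) (hj : Function.Injective j) :
    IsTorsionless e (P ⧸ LinearMap.range j) := by
  intro c hc
  obtain ⟨v, rfl⟩ := Submodule.mkQ_surjective _ c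
  have hv : ∀ x : AE e, ∃ m, j m = op x.1 • v := fun x => by
    have h := hc x
    rw [← map_smul] at h
    exact (Submodule.Quotient.mk_eq_zero _).1 h
  choose h hh using hv
  obtain ⟨m, hm, -⟩ := hM (AddMonoidHom.mk' h fun x y => hj <| by
    rw [map_add, hh, hh, hh, ← add_smul]; rfl) fun c x => hj <| by
      refine (hh _).trans (Eq.trans ?_ (map_smul j (op c.1) (h x)).symm)
      rw [hh, ← mul_smul]
      rfl
  have hjm : j m = v := sub_eq_zero.1 <| hP _ fun x => by
    rw [smul_sub, ← map_smul, ← hm, ← hh, sub_eq_zero]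
    rfl
  exact (Submodule.Quotient.mk_eq_zero _).2 ⟨m, hjm⟩

lemma AE.self_smul_e (he : IsIdempotentElem e) (x : AE e) : x.1 • eAE he = x := Subtype.ext x.2

/-- The element `e x` of `eAe` for `x` in `Ae`. -/
def AE.toCorner (he : IsIdempotentElem e) (x : AE e) : he.Corner :=
  ⟨e * x.1, (Subsemigroup.mem_corner_iff he).2
    ⟨by rw [← mul_assoc, he.eq], by rw [mul_assoc, AE.mul_e x]⟩⟩

/-- Because `x = x e`, the product of two elements of `Ae` is a right `eAe`-multiple of the first.
This is how `eAe`-linearity is applied to such products. -/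
lemma AE.smul_eq_toCorner_smul (he : IsIdempotentElem e) (x x' : AE e) :
    x.1 • x' = op (AE.toCorner he x') • x :=
  Subtype.ext <| by
    change x.1 * x'.1 = x.1 * (e * x'.1)
    rw [← mul_assoc, AE.mul_e x]

lemma Corner.val_algebraMap {K : Type*} [Field K] [Algebra K A] (he : IsIdempotentElem e) (k : K) :
    (algebraMap K he.Corner k).1 = algebraMap K A k * e := by
  rw [← Algebra.smul_def, Algebra.algebraMap_eq_smul_one]
  rfl

lemma AE.smul_eq_op_smul {K : Type*} [Field K] [Algebra K A] (he : IsIdempotentElem e) (k : K)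
    (x : AE e) : k • x = op (algebraMap K he.Corner k) • x :=
  Subtype.ext <| by
    rw [AE.coe_op_smul, unop_op, Corner.val_algebraMap, ← mul_assoc, ← Algebra.commutes, mul_assoc,
      AE.mul_e x, ← Algebra.smul_def]
    rfl

lemma EA.smul_eq_op_smul {K : Type*} [Field K] [Algebra K A] (he : IsIdempotentElem e) (k : K)
    (y : EA e) : algebraMap K he.Corner k • y = op (algebraMap K A k) • y :=
  Subtype.ext <| by
    rw [EA.coe_smul, Corner.val_algebraMap, mul_assoc, EA.e_mul y]
    exact Algebra.commutes _ _

end Closed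

/-! ### The pairing of `eA` and `Ae` -/

section Pairing

variable {K A : Type u} [Field K] [Ring A] [Algebra K A] {e : A} {he : IsIdempotentElem e}
    (θ : BimodEquiv he.Corner A (KDual K (AE e)) (EA e))

/-- The pairing `eA × Ae → K` corresponding to an isomorphism `D(Ae) ≅ eA`. -/
def pairing (y : EA e) : KDual K (AE e) := θ.inv y

lemma pairing_add (y y' : EA e) (x : AE e) :
    pairing θ (y + y') x = pairing θ y x + pairing θ y' x := by
  rw [pairing, show θ.inv (y + y') = θ.inv y + θ.inv y' from θ.inv.map_add' y y']
  rfl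

lemma pairing_smul (c : he.Corner) (y : EA e) (x : AE e) :
    pairing θ (c • y) x = pairing θ y (op c • x) := by
  rw [pairing, show θ.inv (c • y) = c • θ.inv y from θ.inv.map_left c y]
  rfl

lemma pairing_op_smul (a : A) (y : EA e) (x : AE e) :
    pairing θ (op a • y) x = pairing θ y (a • x) := by
  rw [pairing, show θ.inv (op a • y) = op a • θ.inv y from θ.inv.map_right a y]
  rfl

lemma pairing_hom (ψ : KDual K (AE e)) : pairing θ (θ.hom ψ) = ψ := θ.inv_hom ψ

lemma pairing_injective {y y' : EA e} (h : ∀ x, pairing θ y x = pairing θ y' x) : y = y' := by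
  rw [← θ.hom_inv y, ← θ.hom_inv y']
  exact congrArg θ.hom (KDual.ext h)

/-- Every functional on `Ae` is the pairing with some element of `eA`, and functionals separate
points. -/
lemma pairing_right_injective {x x' : AE e} (h : ∀ y, pairing θ y x = pairing θ y x') :
    x = x' := by
  rw [← sub_eq_zero, ← Module.forall_dual_apply_eq_zero_iff K]
  intro ψ
  have hψ : ∀ z, pairing θ (θ.hom ψ) z = ψ z := DFunLike.congr_fun (pairing_hom θ ψ)
  rw [map_sub, ← hψ, ← hψ]
  exact sub_eq_zero.2 (h _)

/-- Every functional on `eA` is given by pairing with an element of `Ae`. -/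
lemma exists_pairing_eq [FiniteDimensional K A] (f : EA e →+ K)
    (hf : ∀ (k : K) y, f (op (algebraMap K A k) • y) = k * f y) :
    ∃ x : AE e, ∀ y, f y = pairing θ y x := by
  have : Module.Finite K (AE e) :=
    Module.Finite.of_injective ((AE e).subtype.restrictScalars K) (AE e).injective_subtype
  -- Transported along `θ`, the functional `f` lives on `D(Ae)`; reflexivity of the finite
  -- dimensional space `Ae` makes it an evaluation.
  let F : Module.Dual K (Module.Dual K (AE e)) :=
    { toFun := fun φ => f (θ.hom φ)
      map_add' := fun φ φ' => by
        rw [← map_add]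
        exact congrArg f (θ.map_add' φ φ')
      map_smul' := fun k φ => by
        have h1 : (k • φ : Module.Dual K (AE e)) =
            (op (algebraMap K A k) • (show KDual K (AE e) from φ) : KDual K (AE e)) :=
          LinearMap.ext fun x => by
            change k • φ x = φ (algebraMap K A k • x)
            rw [← map_smul]
            congr 1
            exact Subtype.ext (Algebra.smul_def k x.1)
        rw [h1]
        exact (congrArg f (θ.map_right _ φ)).trans (hf k _) }
  refine ⟨(Module.evalEquiv K (AE e)).symm F, fun y => ?_⟩
  have h : Module.evalEquiv K (AE e) ((Module.evalEquiv K (AE e)).symm F) (pairing θ y) =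
      F (pairing θ y) := by rw [LinearEquiv.apply_symm_apply]
  rw [Module.evalEquiv_apply] at h
  refine Eq.trans ?_ h.symm
  change f y = f (θ.hom (θ.inv y))
  rw [θ.hom_inv]

/-- If `a Ae = 0`, then `⟨y a, x⟩ = ⟨y, a x⟩ = 0` for all `x` and `y`. So `eA a = 0`, and
faithfulness of `eA` gives `a = 0`. -/
lemma isTorsionless_of_dual (θ : BimodEquiv he.Corner A (KDual K (AE e)) (EA e))
    (hfaith : FaithfulSMul Aᵐᵒᵖ (EA e)) : IsTorsionless e A := by
  intro a ha
  refine op_injective (hfaith.eq_of_smul_eq_smul fun y => pairing_injective θ fun x => ?_)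
  have h : ∀ b : A, b • x = 0 → pairing θ (op b • y) x = 0 := fun b hb => by
    rw [pairing_op_smul, hb, map_zero]
  exact (h a (Subtype.ext (ha x))).trans (h 0 (zero_smul A x)).symm

end Pairing

/-! ### Modules of dominant dimension two over gendo-symmetric algebras -/

section GendoSymmetric

variable {K A : Type u} [Field K] [Ring A] [Algebra K A] {e : A} {he : IsIdempotentElem e}

/-- A finitely generated torsionless module embeds into a finite power of `eA`. -/
lemma IsTorsionless.exists_embedding [FiniteDimensional K A]
    (θ : BimodEquiv he.Corner A (KDual K (AE e)) (EA e)) {M : Type u}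
    [AddCommGroup M] [Module Aᵐᵒᵖ M] [Module.Finite Aᵐᵒᵖ M] (hM : IsTorsionless e M) :
    ∃ (n : ℕ) (j : M →ₗ[Aᵐᵒᵖ] (Fin n → EA e)), Function.Injective j := by
  obtain ⟨n, f, hf, hsep⟩ := exists_separating_functionals K (A := A) M
  refine ⟨n, LinearMap.pi fun i => θ.hom.right ∘ₗ toKDual (AE e).subtype (f i) (hf i), ?_⟩
  rw [← LinearMap.ker_eq_bot, LinearMap.ker_eq_bot']
  intro m hm
  refine hM m fun x => hsep _ fun i => ?_
  have h : θ.hom (toKDual (AE e).subtype (f i) (hf i) m) = 0 := congrFun hm i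
  have h' : toKDual (AE e).subtype (f i) (hf i) m = 0 :=
    θ.toAddEquiv.injective (h.trans θ.toAddEquiv.map_zero.symm)
  exact DFunLike.congr_fun h' x

/-- A map `h : Ae → eA` is recovered from the functional `x ↦ ⟨h(x), e⟩`. If `y` in `eA` represents
it, then `⟨y x, x'⟩ = ⟨y, x (e x')⟩ = ⟨h(x) e x', e⟩ = ⟨h(x), x'⟩`, hence `h(x) = y x`. -/
lemma isCornerClosed_EA (θ : BimodEquiv he.Corner A (KDual K (AE e)) (EA e))
    (hA : IsTorsionless e A) : IsCornerClosed he (EA e) := by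
  refine isCornerClosed_of_exists (hA.of_injective (EA e).subtype (EA e).injective_subtype)
    fun h hh => ?_
  have hlin : ∀ (k : K) x, pairing θ (h (k • x)) (eAE he) = k * pairing θ (h x) (eAE he) := by
    intro k x
    rw [AE.smul_eq_op_smul he, hh, pairing_op_smul, Corner.val_algebraMap, mul_smul,
      show e • eAE he = eAE he from Subtype.ext he, ← smul_eq_mul, ← map_smul]
    congr 1
    exact Subtype.ext (Algebra.smul_def k e).symm
  let ψ : KDual K (AE e) := (LinearMap.mk ⟨fun x => pairing θ (h x) (eAE he), fun x x' => by
    rw [map_add, pairing_add]⟩ hlin : AE e →ₗ[K] K)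
  refine ⟨θ.hom ψ, fun x => pairing_injective θ fun x' => ?_⟩
  rw [pairing_op_smul, AE.smul_eq_toCorner_smul he, pairing_hom]
  change _ = pairing θ (h (op (AE.toCorner he x') • x)) (eAE he)
  rw [hh, pairing_op_smul]
  -- The unit of `eAe` is `e`, so `eAe`-linearity forces `h(x) = h(x) e`.
  have h1 : h x = op e • h x := (congrArg h (one_smul _ x).symm).trans (hh 1 x)
  rw [h1, pairing_op_smul, ← h1]
  congr 1
  exact Subtype.ext (by
    change e * x'.1 = e * x'.1 * e
    rw [mul_assoc, AE.mul_e])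

lemma IsGendoSymmetric.isTorsionless_self (hA : IsGendoSymmetric K he) : IsTorsionless e A := by
  obtain ⟨θ⟩ := hA.dual
  exact isTorsionless_of_dual θ hA.minFaithful.faithful

/-- Positive dominant dimension would embed `M` into a projective module and so make it torsionless;
but `Ae ⊆ AeA` annihilates `M`. -/
lemma IsGendoSymmetric.domDim_eq_zero (hA : IsGendoSymmetric K he) {M : Type u}
    [AddCommGroup M] [Module Aᵐᵒᵖ M] [Nontrivial M]
    (hM : ∀ a ∈ TwoSidedIdeal.span {e}, ∀ m : M, op a • m = 0) : domDim Aᵐᵒᵖ M = 0 := by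
  by_contra h
  obtain ⟨𝓘, h𝓘⟩ := exists_minInjRes_of_le_domDim (R := Aᵐᵒᵖ) (M := M) one_pos
    (by rw [Nat.cast_one]; exact Order.one_le_iff_pos.2 (pos_iff_ne_zero.2 h))
  have ht : IsTorsionless e M := (hA.isTorsionless_self.of_projective
    (h𝓘 0 one_pos)).of_injective 𝓘.ι 𝓘.ι_injective
  obtain ⟨m, hm⟩ := exists_ne (0 : M)
  refine hm (ht m fun x => hM _ ?_ m)
  rw [← AE.mul_e x]
  exact TwoSidedIdeal.mul_mem_left _ _ _ (TwoSidedIdeal.subset_span rfl)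

variable [FiniteDimensional K A]

/-- Projectivity makes `P` torsionless, so it embeds into a power of `eA`. Injectivity splits the
embedding, and closedness passes to powers and retracts. -/
lemma IsGendoSymmetric.isCornerClosed_of_projective_injective (hA : IsGendoSymmetric K he)
    {P : Type u} [AddCommGroup P] [Module Aᵐᵒᵖ P] [Module.Finite Aᵐᵒᵖ P]
    (hP : Module.Projective Aᵐᵒᵖ P) (hP' : Module.Injective Aᵐᵒᵖ P) : IsCornerClosed he P := by
  obtain ⟨θ⟩ := hA.dual
  obtain ⟨n, j, hj⟩ := (hA.isTorsionless_self.of_projective hP).exists_embedding θ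
  obtain ⟨r, hr⟩ := exists_retraction hP' j hj
  exact (IsCornerClosed.pi fun _ => isCornerClosed_EA θ hA.isTorsionless_self).of_retract j r hr

/-- `M` is the kernel of `I₀ → I₁` with both terms projective-injective, hence closed. -/
lemma IsGendoSymmetric.isCornerClosed_of_two_le_domDim (hA : IsGendoSymmetric K he) {M : Type u}
    [AddCommGroup M] [Module Aᵐᵒᵖ M] (hM : 2 ≤ domDim Aᵐᵒᵖ M) : IsCornerClosed he M := by
  obtain ⟨𝓘, h⟩ := exists_minInjRes_of_le_domDim two_pos hM
  exact (hA.isCornerClosed_of_projective_injective (h 0 two_pos) (𝓘.injective 0)).of_exact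
    (hA.isCornerClosed_of_projective_injective (h 1 one_lt_two) (𝓘.injective 1)).isTorsionless
    𝓘.ι 𝓘.ι_injective (𝓘.d 0) 𝓘.exact_zero

/-- `M` embeds into a power of `eA`, and the cokernel is torsionless, so it embeds into another
power. Thus `M` is the kernel of a map between projective-injective modules. -/
lemma IsGendoSymmetric.two_le_domDim_of_isCornerClosed (hA : IsGendoSymmetric K he) {M : Type u}
    [AddCommGroup M] [Module Aᵐᵒᵖ M] [Module.Finite Aᵐᵒᵖ M] (hM : IsCornerClosed he M) :
    2 ≤ domDim Aᵐᵒᵖ M := by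
  have : IsNoetherianRing Aᵐᵒᵖ := IsNoetherianRing.of_finite K Aᵐᵒᵖ
  have : IsArtinianRing Aᵐᵒᵖ := IsArtinianRing.of_finite K Aᵐᵒᵖ
  obtain ⟨θ⟩ := hA.dual
  have hE := isCornerClosed_EA θ hA.isTorsionless_self
  have := hA.minFaithful.projective
  have := hA.minFaithful.injective
  have hproj : ∀ n, Module.Projective Aᵐᵒᵖ (Fin n → EA e) := fun n =>
    Module.Projective.of_equiv (DFinsupp.linearEquivFunOnFintype (R := Aᵐᵒᵖ)
      (M := fun _ : Fin n => EA e))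
  have : Module.Finite Aᵐᵒᵖ A := Module.Finite.of_restrictScalars_finite K Aᵐᵒᵖ A
  have : IsNoetherian Aᵐᵒᵖ A := isNoetherian_of_isNoetherianRing_of_finite Aᵐᵒᵖ A
  obtain ⟨n, a, ha⟩ := hM.isTorsionless.exists_embedding θ
  obtain ⟨m, b, hb⟩ := (hM.isTorsionless_quotient
    (IsTorsionless.pi fun _ => hE.isTorsionless) a ha).exists_embedding θ
  refine (enoughInjectives_op K A).two_le_domDim (hproj n) inferInstance (hproj m) inferInstance
    a ha (b ∘ₗ (LinearMap.range a).mkQ) fun x => ?_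
  rw [LinearMap.comp_apply, map_eq_zero_iff b hb, Submodule.mkQ_apply,
    Submodule.Quotient.mk_eq_zero]
  rfl

end GendoSymmetric

/-! ### The isomorphism `D(A) ≅ Ae ⊗_{eAe} eA` -/

section DualIso

/-- The inverse of a bijective bimodule map. -/
lemma BimodHom.nonempty_equiv_symm {R S X Y : Type*} [Ring R] [Ring S] [AddCommGroup X]
    [AddCommGroup Y] [Module R X] [Module Sᵐᵒᵖ X] [Module R Y] [Module Sᵐᵒᵖ Y]
    (f : BimodHom R S X Y) (hf : Function.Bijective f) : Nonempty (BimodEquiv R S Y X) := by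
  let g := AddEquiv.ofBijective f.toAddMonoidHom hf
  have hg : ∀ x, f.toFun x = g x := fun _ => rfl
  refine ⟨{ g.symm with
    map_left := fun r y => g.injective ?_
    map_right := fun s y => g.injective ?_ }⟩
  · refine (g.apply_symm_apply _).trans (Eq.trans ?_ (f.map_left r _).symm)
    exact congrArg (r • ·) (g.apply_symm_apply y).symm
  · refine (g.apply_symm_apply _).trans (Eq.trans ?_ (f.map_right s _).symm)
    exact congrArg (op s • ·) (g.apply_symm_apply y).symm

variable {K A : Type u} [Field K] [Ring A] [Algebra K A] {e : A} {he : IsIdempotentElem e}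
    (θ : BimodEquiv he.Corner A (KDual K (AE e)) (EA e))

/-- The functional `a ↦ ⟨y, a x⟩` on `A`. -/
def coeffFunctional (x : AE e) (y : EA e) : KDual K A :=
  (LinearMap.mk ⟨fun a => pairing θ y (a • x), fun a b => by rw [add_smul, map_add]⟩
    (fun k a => by
      change pairing θ y ((k • a) • x) = k • pairing θ y (a • x)
      rw [← map_smul]
      congr 1
      exact Subtype.ext (smul_mul_assoc k a x.1)) : A →ₗ[K] K)

lemma coeffFunctional_apply (x : AE e) (y : EA e) (a : A) :
    coeffFunctional θ x y a = pairing θ y (a • x) := rfl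

/-- The bimodule map `Ae ⊗_{eAe} eA → D(A)`, `x ⊗ y ↦ (a ↦ ⟨y, a x⟩)`. -/
def toDualA : BimodHom A A (AeeA he) (KDual K A) where
  toAddMonoidHom := lift (coeffFunctional θ)
    (fun x x' y => KDual.ext fun a => by
      change pairing θ y (a • (x + x')) = pairing θ y (a • x) + pairing θ y (a • x')
      rw [smul_add, map_add])
    (fun x y y' => KDual.ext fun a => pairing_add θ y y' _)
    (fun x c y => KDual.ext fun a => by
      rw [coeffFunctional_apply, coeffFunctional_apply, pairing_smul, smul_comm])
  map_left b t := by
    change lift _ _ _ _ (b • t) = b • lift _ _ _ _ t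
    induction t using induction_on with
    | zero => simp
    | tmul x y =>
      rw [smul_tmul, lift_tmul, lift_tmul]
      exact KDual.ext fun a => by
        rw [coeffFunctional_apply, KDual.smul_apply, coeffFunctional_apply, ← mul_smul]
        rfl
    | add s t hs ht => rw [smul_add, map_add, map_add, smul_add, hs, ht]
  map_right b t := by
    change lift _ _ _ _ (op b • t) = op b • lift _ _ _ _ t
    induction t using induction_on with
    | zero => simp
    | tmul x y =>
      rw [op_smul_tmul', lift_tmul, lift_tmul]
      exact KDual.ext fun a => by
        rw [coeffFunctional_apply, KDual.op_smul_apply, coeffFunctional_apply, pairing_op_smul,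
          ← mul_smul]
        rfl
    | add s t hs ht => rw [smul_add, map_add, map_add, smul_add, hs, ht]

lemma toDualA_tmul (x : AE e) (y : EA e) (a : A) :
    toDualA θ (tmul he.Corner x y) a = pairing θ y (a • x) := rfl

lemma toDualA_add (s t : AeeA he) : toDualA θ (s + t) = toDualA θ s + toDualA θ t :=
  (toDualA θ).map_add' s t

lemma algebraMap_smul_tmul (k : K) (x : AE e) (y : EA e) :
    algebraMap K A k • tmul he.Corner x y = tmul he.Corner x (op (algebraMap K A k) • y) := by
  rw [smul_tmul, ← EA.smul_eq_op_smul he, ← op_smul_tmul, ← AE.smul_eq_op_smul he]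
  congr 1
  exact Subtype.ext (Algebra.smul_def k x.1).symm

variable [FiniteDimensional K A]

/-- Every functional on `Ae ⊗_{eAe} eA` comes from an element of `A`. -/
lemma exists_functional_eq (hA : IsCornerClosed he A) (f : AeeA he →+ K)
    (hf : ∀ (k : K) t, f (algebraMap K A k • t) = k * f t) :
    ∃ a : A, ∀ t, f t = toDualA θ t a := by
  -- Currying: for fixed `x` the functional `f(x ⊗ -)` on `eA` is the pairing with an element `h(x)`
  -- of `Ae`.
  have hex : ∀ x : AE e, ∃ x' : AE e, ∀ y, f (tmul he.Corner x y) = pairing θ y x' := fun x =>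
    exists_pairing_eq θ (AddMonoidHom.mk' (fun y => f (tmul he.Corner x y)) fun y y' => by
      rw [tmul_add, map_add]) fun k y => by
        refine Eq.trans ?_ (hf k _)
        rw [algebraMap_smul_tmul]
        rfl
  choose h hh using hex
  -- The map `h : Ae → Ae ⊆ A` is right `eAe`-linear, so closedness of `A` makes it left
  -- multiplication by some `a`.
  obtain ⟨a, ha, -⟩ := hA (AddMonoidHom.mk' (fun x => (h x).1) fun x x' => by
    refine congrArg Subtype.val (pairing_right_injective θ (x' := h x + h x') fun y => ?_)
    rw [← hh, map_add, ← hh, ← hh, add_tmul, map_add]) fun c x => by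
      refine congrArg Subtype.val (pairing_right_injective θ (x' := op c • h x) fun y => ?_)
      rw [← hh, ← pairing_smul, ← hh, op_smul_tmul]
  refine ⟨a, fun t => ?_⟩
  induction t using induction_on with
  | zero =>
    rw [map_zero, show toDualA θ 0 = 0 from (toDualA θ).map_zero']
    rfl
  | tmul x y =>
    rw [hh, toDualA_tmul]
    congr 1
    exact Subtype.ext (ha x)
  | add s t hs ht =>
    rw [map_add, toDualA_add, hs, ht]
    rfl

/-- Every functional on the tensor product factors through `toDualA`, as evaluation at some `a`. So
an element of the kernel is killed by all functionals; no dimension count is needed. -/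
lemma toDualA_injective (hA : IsCornerClosed he A) : Function.Injective (toDualA θ) := by
  refine (injective_iff_map_eq_zero (toDualA θ).toAddMonoidHom).2 fun t ht => ?_
  let _ : Module K (AeeA he) := Module.compHom _ (algebraMap K A)
  rw [← Module.forall_dual_apply_eq_zero_iff K]
  intro ψ
  obtain ⟨a, ha⟩ := exists_functional_eq θ hA ψ.toAddMonoidHom ψ.map_smul
  exact (ha t).trans (DFunLike.congr_fun (f := toDualA θ t) (g := 0) ht a)

/-- If the image were proper, a nonzero functional on `D(A)`, necessarily evaluation at some `a`,
would vanish on it. Then `⟨y, a x⟩ = 0` for all `x` and `y`, so `a Ae = 0` and `a = 0`. -/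
lemma toDualA_surjective (hA : IsTorsionless e A) : Function.Surjective (toDualA θ) := by
  let S : Submodule K (Module.Dual K A) :=
    { carrier := Set.range (toDualA θ)
      add_mem' := by
        rintro _ _ ⟨s, rfl⟩ ⟨t, rfl⟩
        exact ⟨s + t, toDualA_add θ s t⟩
      zero_mem' := ⟨0, (toDualA θ).map_zero'⟩
      smul_mem' := by
        rintro k _ ⟨t, rfl⟩
        refine ⟨algebraMap K A k • t, ((toDualA θ).map_left _ t).trans (KDual.ext fun a => ?_)⟩
        change toDualA θ t (a * algebraMap K A k) = k • toDualA θ t a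
        rw [← map_smul, ← Algebra.commutes, ← Algebra.smul_def] }
  suffices hS : S = ⊤ from fun f => by
    have hf : (show Module.Dual K A from f) ∈ S := hS ▸ Submodule.mem_top
    exact hf
  by_contra hS
  obtain ⟨F, hF, hle⟩ := Submodule.exists_le_ker_of_lt_top S (lt_top_iff_ne_top.2 hS)
  obtain ⟨a, rfl⟩ := (Module.evalEquiv K A).surjective F
  refine hF ?_
  rw [hA a fun x => ?_, map_zero]
  have hx : a • x = 0 := pairing_right_injective θ fun y => by
    rw [map_zero]
    exact hle ⟨tmul he.Corner x y, rfl⟩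
  exact congrArg Subtype.val hx

lemma IsGendoSymmetric.nonempty_dual_equiv (hA : IsGendoSymmetric K he) :
    Nonempty (BimodEquiv A A (KDual K A) (AeeA he)) := by
  obtain ⟨θ⟩ := hA.dual
  exact (toDualA θ).nonempty_equiv_symm
    ⟨toDualA_injective θ (hA.isCornerClosed_of_two_le_domDim hA.two_le_domDim),
      toDualA_surjective θ hA.isTorsionless_self⟩

end DualIso

/-! ### The `eAe`-module `Me` -/

section CornerPart

variable {A : Type*} [Ring A] {e : A} (he : IsIdempotentElem e)

/-- The subgroup `Me` of a right `A`-module `M`. -/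
def cornerPart (e : A) (M : Type*) [AddCommGroup M] [Module Aᵐᵒᵖ M] : AddSubgroup M where
  carrier := {m | op e • m = m}
  zero_mem' := smul_zero _
  add_mem' {x y} hx hy := (smul_add _ x y).trans (congrArg₂ _ hx hy)
  neg_mem' {x} hx := (smul_neg _ x).trans (congrArg _ hx)

variable {M N : Type*} [AddCommGroup M] [Module Aᵐᵒᵖ M] [AddCommGroup N] [Module Aᵐᵒᵖ N]

lemma op_smul_mem_cornerPart {a : A} (ha : a * e = a) (m : M) : op a • m ∈ cornerPart e M := by
  change op e • op a • m = op a • m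
  rw [← mul_smul, ← op_mul, ha]

instance : Module (he.Corner)ᵐᵒᵖ (cornerPart e M) where
  smul c m := ⟨op c.unop.1 • m.1, op_smul_mem_cornerPart (corner_right he c.unop) m.1⟩
  one_smul m := Subtype.ext m.2
  mul_smul c d m := Subtype.ext (mul_smul (op c.unop.1) (op d.unop.1) m.1)
  smul_zero _ := Subtype.ext (smul_zero _)
  smul_add _ m n := Subtype.ext (smul_add _ m.1 n.1)
  add_smul c d m := Subtype.ext (add_smul (op c.unop.1) (op d.unop.1) m.1)
  zero_smul m := Subtype.ext (zero_smul Aᵐᵒᵖ m.1)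

lemma cornerPart.coe_smul (c : (he.Corner)ᵐᵒᵖ) (m : cornerPart e M) :
    (c • m : cornerPart e M).1 = op c.unop.1 • m.1 := rfl

/-- The restriction `Me → Ne` of an `A`-linear map `M → N`. -/
def cornerRestrict (f : M →ₗ[Aᵐᵒᵖ] N) : cornerPart e M →ₗ[(he.Corner)ᵐᵒᵖ] cornerPart e N where
  toFun m := ⟨f m.1, (map_smul f _ _).symm.trans (congrArg f m.2)⟩
  map_add' x y := Subtype.ext (map_add f x.1 y.1)
  map_smul' _ x := Subtype.ext (map_smul f _ x.1)

lemma finite_cornerPart (K : Type*) [Field K] [Algebra K A] [FiniteDimensional K A]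
    [Module.Finite Aᵐᵒᵖ M] : Module.Finite (he.Corner)ᵐᵒᵖ (cornerPart e M) := by
  let _ := rightVectorSpace K A M
  have := rightVectorSpace_finite (K := K) A M
  let _ := rightVectorSpace K he.Corner (cornerPart e M)
  have := rightVectorSpace_isScalarTower (K := K) he.Corner (cornerPart e M)
  let j : cornerPart e M →ₗ[K] M :=
    { toFun := fun m => m.1
      map_add' := fun _ _ => rfl
      map_smul' := fun k m => by
        change op (algebraMap K he.Corner k).1 • m.1 = op (algebraMap K A k) • m.1
        rw [Corner.val_algebraMap, Algebra.commutes, op_mul, mul_smul,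
          show op e • m.1 = m.1 from m.2] }
  have : Module.Finite K (cornerPart e M) := Module.Finite.of_injective j Subtype.val_injective
  exact Module.Finite.of_restrictScalars_finite K (he.Corner)ᵐᵒᵖ _

/-- The element `y e` of `eAe` for `y` in `eA`. -/
def EA.toCorner (y : EA e) : he.Corner :=
  ⟨y.1 * e, (Subsemigroup.mem_corner_iff he).2
    ⟨by rw [← mul_assoc, EA.e_mul], by rw [mul_assoc, he.eq]⟩⟩

lemma EA.e_op_smul (y : EA e) : op y.1 • eEA he = y := Subtype.ext (EA.e_mul y)

lemma EA.op_smul_eq_toCorner_smul (y : EA e) : op e • y = EA.toCorner he y • eEA he :=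
  Subtype.ext <| by
    change y.1 * e = y.1 * e * e
    rw [mul_assoc, he.eq]

variable {X : Type*} [AddCommGroup X] [Module (he.Corner)ᵐᵒᵖ X]

/-- The map `X ⊗_{eAe} eA → X`, `x ⊗ y ↦ x y e`. -/
def tensorEAToBase : BTensor he.Corner X (EA e) →+ X :=
  lift (fun x y => op (EA.toCorner he y) • x) (fun x x' y => smul_add _ x x')
    (fun x y y' => by
      rw [← add_smul, ← MulOpposite.op_add]
      congr 2
      exact Subtype.ext (add_mul y.1 y'.1 e))
    (fun x c y => by
      rw [← mul_smul, ← op_mul]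
      congr 2
      exact Subtype.ext (mul_assoc c.1 y.1 e).symm)

/-- Since `y e` lies in `eAe`, one has `(x ⊗ y) e = x ⊗ (y e) e = x (y e) ⊗ e`. -/
lemma op_e_smul_eq_tmul (t : BTensor he.Corner X (EA e)) :
    op e • t = tmul he.Corner (tensorEAToBase he t) (eEA he) := by
  induction t using induction_on with
  | zero => simp
  | tmul x y =>
    rw [op_smul_tmul', EA.op_smul_eq_toCorner_smul he, ← op_smul_tmul]
    rfl
  | add s t hs ht => rw [smul_add, map_add, hs, ht, add_tmul]

/-- The isomorphism `X ≅ (X ⊗_{eAe} eA)e`. -/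
noncomputable def baseEquivCornerPart :
    X ≃ₗ[(he.Corner)ᵐᵒᵖ] cornerPart e (BTensor he.Corner X (EA e)) where
  toFun x := ⟨tmul he.Corner x (eEA he), by
    change op e • tmul he.Corner x (eEA he) = _
    rw [op_smul_tmul', show op e • eEA he = eEA he from EA.e_op_smul he (eEA he)]⟩
  map_add' x x' := Subtype.ext (add_tmul x x' _)
  map_smul' c x := Subtype.ext <| by
    change tmul he.Corner (c • x) (eEA he) = op c.unop.1 • tmul he.Corner x (eEA he)
    rw [← op_unop c, op_smul_tmul, op_smul_tmul']
    congr 1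
    exact Subtype.ext ((corner_right he c.unop).trans (corner_left he c.unop).symm)
  invFun t := tensorEAToBase he t.1
  left_inv x := by
    change op (EA.toCorner he (eEA he)) • x = x
    rw [show EA.toCorner he (eEA he) = 1 from Subtype.ext he, op_one, one_smul]
  right_inv t := Subtype.ext ((op_e_smul_eq_tmul he t.1).symm.trans t.2)

/-- As `x ⊗ y = (x ⊗ e) y`, the elements `s ⊗ e` generate when `s` runs through generators of `X`.
-/
lemma finite_tensor_EA [Module.Finite (he.Corner)ᵐᵒᵖ X] :
    Module.Finite Aᵐᵒᵖ (BTensor he.Corner X (EA e)) := by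
  obtain ⟨S, hS⟩ := Module.Finite.fg_top (R := (he.Corner)ᵐᵒᵖ) (M := X)
  classical
  refine ⟨⟨S.image fun x => tmul he.Corner x (eEA he), ?_⟩⟩
  rw [eq_top_iff]
  rintro t -
  set T := Submodule.span Aᵐᵒᵖ
    ((S.image fun x => tmul he.Corner x (eEA he) : Finset _) : Set (BTensor he.Corner X (EA e)))
  have key : ∀ x ∈ Submodule.span (he.Corner)ᵐᵒᵖ (S : Set X), ∀ y : EA e,
      tmul he.Corner x y ∈ T := by
    intro x hx
    induction hx using Submodule.span_induction with
    | mem x hx =>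
      intro y
      rw [← EA.e_op_smul he y, ← op_smul_tmul']
      exact T.smul_mem _ (Submodule.subset_span (Finset.mem_coe.2 (Finset.mem_image_of_mem _ hx)))
    | zero => intro y; rw [zero_tmul]; exact T.zero_mem
    | add x x' _ _ hx hx' => intro y; rw [add_tmul]; exact T.add_mem (hx y) (hx' y)
    | smul c x _ hx => intro y; rw [← op_unop c, op_smul_tmul]; exact hx _
  induction t using induction_on with
  | zero => exact T.zero_mem
  | tmul x y => exact key x (hS ▸ Submodule.mem_top) y
  | add s t hs ht => exact T.add_mem hs ht

end CornerPart

/-! ### Generators of `D(A)` -/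

section Generator

variable {K A : Type u} [Field K] [Ring A] [Algebra K A] {e : A} {he : IsIdempotentElem e}
    (Θ : BimodEquiv A A (KDual K A) (AeeA he))

/-- The element of `D(A)` that corresponds to `x ⊗ y`. -/
def dualTmul (x : AE e) (y : EA e) : KDual K A := Θ.inv (tmul he.Corner x y)

/-- The element of `D(A)` that corresponds to `e ⊗ e`. -/
def dualGen : KDual K A := dualTmul Θ (eAE he) (eEA he)

lemma hom_dualTmul (x : AE e) (y : EA e) : Θ.hom (dualTmul Θ x y) = tmul he.Corner x y :=
  Θ.hom_inv _

lemma smul_dualTmul (a : A) (x : AE e) (y : EA e) :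
    a • dualTmul Θ x y = dualTmul Θ (a • x) y :=
  (Θ.inv.map_left a _).symm

lemma op_smul_dualTmul (a : A) (x : AE e) (y : EA e) :
    op a • dualTmul Θ x y = dualTmul Θ x (op a • y) :=
  (Θ.inv.map_right a _).symm

lemma dualTmul_op_smul (c : he.Corner) (x : AE e) (y : EA e) :
    dualTmul Θ (op c • x) y = dualTmul Θ x (c • y) :=
  congrArg Θ.inv (op_smul_tmul c x y)

lemma dualTmul_add (x x' : AE e) (y : EA e) :
    dualTmul Θ (x + x') y = dualTmul Θ x y + dualTmul Θ x' y :=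
  (congrArg Θ.inv (add_tmul x x' y)).trans (Θ.inv.map_add' _ _)

/-- This shows that `e ⊗ e` generates `D(A)` as a bimodule, so a bimodule-type computation can be
reduced to this one element. -/
lemma dualTmul_eq (x : AE e) (y : EA e) : dualTmul Θ x y = x.1 • op y.1 • dualGen Θ := by
  rw [dualGen, op_smul_dualTmul, smul_dualTmul, AE.self_smul_e, EA.e_op_smul]

/-- An element `c` of `eAe` moves across the tensor sign: `c ⊗ e = e ⊗ c`. -/
lemma corner_smul_dualGen (c : he.Corner) : c.1 • dualGen Θ = op c.1 • dualGen Θ := by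
  rw [dualGen, op_smul_dualTmul, smul_dualTmul,
    show c.1 • eAE he = op c • eAE he from
      Subtype.ext ((corner_right he c).trans (corner_left he c).symm), dualTmul_op_smul]
  congr 1
  exact Subtype.ext ((corner_right he c).trans (corner_left he c).symm)

lemma op_e_smul_dualGen : op e • dualGen Θ = dualGen Θ := by
  rw [dualGen, op_smul_dualTmul, show op e • eEA he = eEA he from EA.e_op_smul he (eEA he)]

/-- The generator is grouplike; therefore evaluation at it turns composition in `𝓑-mod` into
ordinary composition. -/
lemma comul_dualGen : (bocsDA he Θ).comul (dualGen Θ) = tmul A (dualGen Θ) (dualGen Θ) := by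
  change tmap Θ.inv.right Θ.inv.left (canComul he (Θ.hom (dualGen Θ))) = _
  rw [dualGen, hom_dualTmul]
  rfl

/-- Two right linear maps on `D(A)` agree if they agree on the elements `x ⊗ y`. -/
lemma RHom.ext_dualTmul {N : Type*} [AddCommGroup N] [Module Aᵐᵒᵖ N] {f g : RHom A (KDual K A) N}
    (h : ∀ x y, f (dualTmul Θ x y) = g (dualTmul Θ x y)) : f = g := by
  refine RHom.ext fun w => ?_
  have key : ∀ t : AeeA he, f (Θ.inv t) = g (Θ.inv t) := by
    intro t
    induction t using induction_on with
    | zero => rw [show Θ.inv 0 = 0 from Θ.inv.map_zero', map_zero, map_zero]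
    | tmul x y => exact h x y
    | add s t hs ht =>
      rw [show Θ.inv (s + t) = Θ.inv s + Θ.inv t from Θ.inv.map_add' s t, map_add, map_add, hs, ht]
  rw [← Θ.inv_hom w]
  exact key _

/-- The map `Ae ⊗_{eAe} eA → N`, `x ⊗ y ↦ h(x) y` for a map `h : Ae → N` of right
`eAe`-modules. -/
def liftAE {N : Type*} [AddCommGroup N] [Module Aᵐᵒᵖ N] (h : AE e →+ N)
    (hh : ∀ (c : he.Corner) x, h (op c • x) = op c.1 • h x) : AeeA he →+ N :=
  lift (fun x y => op y.1 • h x) (fun x x' y => by rw [map_add, smul_add])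
    (fun x y y' => by rw [← add_smul, ← MulOpposite.op_add]; rfl)
    (fun x c y => by rw [hh, ← mul_smul]; rfl)

/-- The map `D(A) → N` with `x ⊗ y ↦ h(x) y` for a map `h : Ae → N` of right `eAe`-modules. -/
def RHom.ofAE {N : Type*} [AddCommGroup N] [Module Aᵐᵒᵖ N] (h : AE e →+ N)
    (hh : ∀ (c : he.Corner) x, h (op c • x) = op c.1 • h x) : RHom A (KDual K A) N :=
  (LinearMap.mk ((liftAE h hh).comp Θ.hom.toAddMonoidHom).toAddHom
    (fun a w => by
      change liftAE h hh (Θ.hom (a • w)) = a • liftAE h hh (Θ.hom w)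
      rw [show Θ.hom (a • w) = a • Θ.hom w from Θ.map_right a.unop w]
      generalize Θ.hom w = t
      induction t using induction_on with
      | zero => simp
      | tmul x y => exact mul_smul a (op y.1) (h x)
      | add s t hs ht => rw [smul_add, map_add, map_add, smul_add, hs, ht]) :
    KDual K A →ₗ[Aᵐᵒᵖ] N)

lemma RHom.ofAE_dualTmul {N : Type*} [AddCommGroup N] [Module Aᵐᵒᵖ N] (h : AE e →+ N)
    (hh : ∀ (c : he.Corner) x, h (op c • x) = op c.1 • h x) (x : AE e) (y : EA e) :
    RHom.ofAE Θ h hh (dualTmul Θ x y) = op y.1 • h x := by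
  change liftAE h hh (Θ.hom (dualTmul Θ x y)) = _
  rw [hom_dualTmul]
  rfl

variable {M : Type*} [AddCommGroup M] [Module Aᵐᵒᵖ M]

lemma IMap_dualTmul (m : M) (x : AE e) (y : EA e) :
    IMap he Θ M m (dualTmul Θ x y) = op (x.1 * y.1) • m := by
  change op (mulMap he (Θ.hom (dualTmul Θ x y))) • m = _
  rw [hom_dualTmul, mulMap_tmul]

/-- A map `f : D(A) → M` amounts to the `eAe`-linear map `x ↦ f(x ⊗ e)` on `Ae`. Under this
identification `I_M` is the canonical map that closedness declares bijective. -/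
lemma IMap_bijective (hM : IsCornerClosed he M) : Function.Bijective (IMap he Θ M) := by
  constructor
  · refine (injective_iff_map_eq_zero _).2 fun m hm => hM.isTorsionless m fun x => ?_
    have h := DFunLike.congr_fun hm (dualTmul Θ x (eEA he))
    rw [IMap_dualTmul] at h
    change op (x.1 * e) • m = 0 at h
    rwa [AE.mul_e] at h
  · intro f
    obtain ⟨m, hm, -⟩ := hM (AddMonoidHom.mk' (fun x => f (dualTmul Θ x (eEA he))) fun x x' => by
      rw [dualTmul_add, map_add]) fun c x => by
        change f (dualTmul Θ (op c • x) (eEA he)) = op c.1 • f (dualTmul Θ x (eEA he))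
        rw [dualTmul_op_smul, ← map_smul, op_smul_dualTmul]
        congr 2
        exact Subtype.ext ((corner_right he c).trans (corner_left he c).symm)
    refine ⟨m, RHom.ext_dualTmul Θ fun x y => ?_⟩
    rw [IMap_dualTmul, op_mul, mul_smul, ← hm]
    change op y.1 • f (dualTmul Θ x (eEA he)) = _
    rw [← map_smul, op_smul_dualTmul, EA.e_op_smul]

end Generator

/-! ### The functors between `mod-A`, `𝓑-mod` and `mod-eAe` -/

section Functors

variable {K A : Type u} [Field K] [Ring A] [Algebra K A] {e : A} {he : IsIdempotentElem e}
    (Θ : BimodEquiv A A (KDual K A) (AeeA he))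

/-- `Hom_A(D(A), M)` is determined by its restriction to `eAe`. -/
lemma isCornerClosed_rHom (Θ : BimodEquiv A A (KDual K A) (AeeA he)) (M : Type*) [AddCommGroup M] [Module Aᵐᵒᵖ M] :
    IsCornerClosed he (RHom A (KDual K A) M) := by
  refine isCornerClosed_of_exists (fun f hf => RHom.ext_dualTmul Θ fun x y => ?_) fun h hh => ?_
  · have h := DFunLike.congr_fun (hf x) (dualTmul Θ (eAE he) y)
    rw [RHom.smul_apply, unop_op, smul_dualTmul, AE.self_smul_e] at h
    exact h
  -- The element representing `h` must send `x ⊗ y` to `h(x)(e ⊗ e) y`, because `x` acts by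
  -- multiplication inside the argument.
  · refine ⟨RHom.ofAE Θ (AddMonoidHom.mk' (fun x => h x (dualGen Θ)) fun x x' => by
      rw [map_add, RHom.add_apply]) fun c x => ?_, fun x => RHom.ext_dualTmul Θ fun x' y => ?_⟩
    · change h (op c • x) (dualGen Θ) = op c.1 • h x (dualGen Θ)
      rw [hh, RHom.smul_apply, unop_op, corner_smul_dualGen, map_smul]
    · rw [RHom.smul_apply, unop_op, smul_dualTmul, AE.smul_eq_toCorner_smul he, RHom.ofAE_dualTmul]
      change _ = op y.1 • h (op (AE.toCorner he x') • x) (dualGen Θ)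
      have h1 : h x = op e • h x := (congrArg h (one_smul _ x).symm).trans (hh 1 x)
      rw [hh, RHom.smul_apply, unop_op, ← map_smul, h1, RHom.smul_apply, dualTmul_eq, ← h1,
        unop_op, ← mul_smul e]
      exact congrArg (h x) (smul_comm (e * x'.1) (op y.1) (dualGen Θ))

/-- The functor `φ : mod-A → 𝓑-mod`. -/
def phiFunctor : FGModuleCat.{u} Aᵐᵒᵖ ⥤ BocsMod (bocsDA he Θ) where
  obj M := ⟨M⟩
  map {_ N} f := (IMap he Θ N).comp f.hom.hom
  map_id _ := rfl
  map_comp {L M N} f g := by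
    refine LinearMap.ext fun l => ?_
    -- `I_M` is by definition the identity of `M` in `𝓑-mod`, so composing with `I_M f` is
    -- precomposing with `f`, by the unit law.
    exact (LinearMap.congr_fun ((bocsDA he Θ).conv_unit ((IMap he Θ N).comp g.hom.hom))
      (f.hom.hom l)).symm

instance : (phiFunctor Θ).Additive where
  map_add {_ N} f g := LinearMap.ext fun m => map_add (IMap he Θ N) (f.hom.hom m) (g.hom.hom m)

instance : (phiFunctor Θ).Linear K where
  map_smul {_ N} f k := LinearMap.ext fun m =>
    map_smul (IMap he Θ N) (op (algebraMap K A k)) (f.hom.hom m)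

/-- The identity of `φ(M)` is `I_M`, which vanishes exactly when `m a e b = 0` for all `m`, `a`,
`b`. -/
lemma isZero_phiFunctor_iff (M : FGModuleCat.{u} Aᵐᵒᵖ) :
    Limits.IsZero ((phiFunctor Θ).obj M) ↔
      ∀ a ∈ TwoSidedIdeal.span {e}, ∀ m : M, op a • m = 0 := by
  rw [Limits.IsZero.iff_id_eq_zero]
  constructor
  · intro h
    have he0 : ∀ m : M, op e • m = 0 := fun m => by
      have h1 : IMap he Θ M m (dualGen Θ) = 0 :=
        DFunLike.congr_fun (LinearMap.congr_fun h m) (dualGen Θ)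
      rw [dualGen, IMap_dualTmul] at h1
      change op (e * e) • m = 0 at h1
      rwa [he.eq] at h1
    -- The annihilator of `M` is a two-sided ideal; once it contains `e` it contains `AeA`.
    let I : TwoSidedIdeal A := TwoSidedIdeal.mk' {a | ∀ m : M, op a • m = 0}
      (fun m => zero_smul Aᵐᵒᵖ m)
      (fun {a b} ha hb m => by rw [MulOpposite.op_add, add_smul, ha, hb, add_zero])
      (fun {a} ha m => by rw [MulOpposite.op_neg, neg_smul, ha, neg_zero])
      (fun {a b} hb m => by rw [op_mul, mul_smul, hb])
      (fun {a b} ha m => by rw [op_mul, mul_smul, ha, smul_zero])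
    have hI : TwoSidedIdeal.span {e} ≤ I := TwoSidedIdeal.span_le.2 (by
      rintro _ rfl
      exact (TwoSidedIdeal.mem_mk' _ _ _ _ _ _ _).2 he0)
    exact fun a ha => (TwoSidedIdeal.mem_mk' _ _ _ _ _ _ _).1 (hI ha)
  · intro h
    refine LinearMap.ext fun m => RHom.ext_dualTmul Θ fun x y => ?_
    refine (IMap_dualTmul Θ m x y).trans (h _ ?_ m)
    rw [← EA.e_mul y]
    exact TwoSidedIdeal.mul_mem_left _ _ _
      (TwoSidedIdeal.mul_mem_right _ _ _ (TwoSidedIdeal.subset_span rfl))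

/-- On morphisms `φ` is composition with `I_N`, so only the target has to be closed. -/
lemma phi_map_bijective {M N : FGModuleCat.{u} Aᵐᵒᵖ} (hN : IsCornerClosed he N) :
    Function.Bijective ((phiFunctor Θ).map : (M ⟶ N) → _) := by
  have hI := IMap_bijective Θ hN
  constructor
  · intro f g hfg
    ext m
    exact hI.1 (LinearMap.congr_fun hfg m)
  · intro g
    let g' : M →ₗ[Aᵐᵒᵖ] RHom A (KDual K A) N := g
    refine ⟨FGModuleCat.ofHom ((LinearEquiv.ofBijective _ hI).symm.toLinearMap ∘ₗ g'),
      LinearMap.ext fun m => ?_⟩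
    exact (LinearEquiv.ofBijective _ hI).apply_symm_apply (g' m)

/-- The map `Me → Ne` induced by a morphism `M → N` of the module category of the bocs. -/
def bocsRestrict {M N : Type*} [AddCommGroup M] [Module Aᵐᵒᵖ M] [AddCommGroup N] [Module Aᵐᵒᵖ N]
    (f : M →ₗ[Aᵐᵒᵖ] RHom A (KDual K A) N) :
    cornerPart e M →ₗ[(he.Corner)ᵐᵒᵖ] cornerPart e N where
  toFun m := ⟨f m.1 (dualGen Θ), by
    change op e • f m.1 (dualGen Θ) = _
    rw [← map_smul, op_e_smul_dualGen]⟩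
  map_add' m m' := Subtype.ext <| by
    change f (m.1 + m'.1) (dualGen Θ) = f m.1 (dualGen Θ) + f m'.1 (dualGen Θ)
    rw [map_add, RHom.add_apply]
  map_smul' c m := Subtype.ext <| by
    change f (op c.unop.1 • m.1) (dualGen Θ) = op c.unop.1 • f m.1 (dualGen Θ)
    rw [map_smul, RHom.smul_apply, unop_op, corner_smul_dualGen, map_smul]

lemma bocsRestrict_apply {M N : Type*} [AddCommGroup M] [Module Aᵐᵒᵖ M] [AddCommGroup N]
    [Module Aᵐᵒᵖ N] (f : M →ₗ[Aᵐᵒᵖ] RHom A (KDual K A) N) (m : cornerPart e M) :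
    (bocsRestrict Θ f m).1 = f m.1 (dualGen Θ) := rfl

/-- The identity `f(m)(x ⊗ y) = f(m x)(e ⊗ e) y`, with `m x` in `Me`, shows that `f` is determined
by its restriction. Conversely, `h : Me → Ne` yields `f(m)(x ⊗ y) = h(m x) y`. No condition on `M`
or `N` is needed. -/
lemma bocsRestrict_bijective {M N : Type*} [AddCommGroup M] [Module Aᵐᵒᵖ M] [AddCommGroup N]
    [Module Aᵐᵒᵖ N] : Function.Bijective
      (bocsRestrict Θ : (M →ₗ[Aᵐᵒᵖ] RHom A (KDual K A) N) → _) := by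
  constructor
  · intro f g hfg
    refine LinearMap.ext fun m => RHom.ext_dualTmul Θ fun x y => ?_
    have h : ∀ p : M →ₗ[Aᵐᵒᵖ] RHom A (KDual K A) N, p m (dualTmul Θ x y) =
        op y.1 • (bocsRestrict Θ p ⟨op x.1 • m, op_smul_mem_cornerPart (AE.mul_e x) m⟩).1 := by
      intro p
      rw [bocsRestrict_apply, map_smul, RHom.smul_apply, unop_op, dualTmul_eq, smul_comm, map_smul]
    rw [h, h, hfg]
  · intro h
    let r (m : M) : AE e →+ cornerPart e M := AddMonoidHom.mk'
      (fun x => ⟨op x.1 • m, op_smul_mem_cornerPart (AE.mul_e x) m⟩)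
      fun x x' => Subtype.ext (add_smul (op x.1) (op x'.1) m)
    have hr : ∀ m (c : he.Corner) x, r m (op c • x) = op c • r m x := fun m c x =>
      Subtype.ext (mul_smul (op c.1) (op x.1) m)
    let F (m : M) : RHom A (KDual K A) N := RHom.ofAE Θ
      ((cornerPart e N).subtype.comp (h.toAddMonoidHom.comp (r m))) fun c x => by
        change (h (r m (op c • x))).1 = op c.1 • (h (r m x)).1
        rw [hr, map_smul]
        rfl
    have hF : ∀ m x y, F m (dualTmul Θ x y) = op y.1 • (h (r m x)).1 := fun m x y =>
      RHom.ofAE_dualTmul Θ _ _ x y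
    refine ⟨{
      toFun := F
      map_add' := fun m m' => RHom.ext_dualTmul Θ fun x y => by
        rw [RHom.add_apply, hF, hF, hF, ← smul_add]
        congr 1
        rw [show r (m + m') x = r m x + r m' x from Subtype.ext (smul_add (op x.1) m m'), map_add]
        rfl
      map_smul' := fun a m => RHom.ext_dualTmul Θ fun x y => by
        change F (a • m) _ = (a • F m) _
        rw [RHom.smul_apply, smul_dualTmul, hF, hF]
        congr 3
        exact Subtype.ext (mul_smul (op x.1) a m).symm }, ?_⟩
    refine LinearMap.ext fun m => Subtype.ext ?_
    rw [bocsRestrict_apply]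
    refine (hF m.1 _ _).trans ?_
    rw [show r m.1 (eAE he) = m from Subtype.ext m.2]
    exact (h m).2

lemma phi_dom2_lift_additive (h : ∀ M, Dom2B he Θ (((Dom2 A).ι ⋙ phiFunctor Θ).obj M)) :
    ((Dom2B he Θ).lift ((Dom2 A).ι ⋙ phiFunctor Θ) h).Additive where
  map_add {_ _} f g := ObjectProperty.hom_ext _
    ((phiFunctor Θ).map_add (f := f.hom) (g := g.hom))

lemma phi_dom2_lift_linear (h : ∀ M, Dom2B he Θ (((Dom2 A).ι ⋙ phiFunctor Θ).obj M)) :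
    ((Dom2B he Θ).lift ((Dom2 A).ι ⋙ phiFunctor Θ) h).Linear K where
  map_smul {_ _} f k := ObjectProperty.hom_ext _ ((phiFunctor Θ).map_smul k f.hom)

variable [FiniteDimensional K A]

/-- The functor `𝓑-mod → mod-eAe`, `M ↦ Me`. -/
def cornerFunctor : BocsMod (bocsDA he Θ) ⥤ FGModuleCat.{u} he.Cornerᵐᵒᵖ where
  obj M :=
    have := finite_cornerPart he (M := M.toMod) K
    FGModuleCat.of he.Cornerᵐᵒᵖ (cornerPart e M.toMod)
  map {M N} f := ObjectProperty.homMk (ModuleCat.ofHom (bocsRestrict Θ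
    (show M.toMod →ₗ[Aᵐᵒᵖ] RHom A (KDual K A) N.toMod from f)))
  map_id M := by
    refine FGModuleCat.hom_ext (LinearMap.ext fun m =>
      Subtype.ext ((IMap_dualTmul Θ m.1 _ _).trans ?_))
    change op (e * e) • m.1 = m.1
    rw [he.eq]
    exact m.2
  map_comp {L M N} f g := by
    refine FGModuleCat.hom_ext (LinearMap.ext fun l => Subtype.ext ?_)
    let f' : L.toMod →ₗ[Aᵐᵒᵖ] RHom A (KDual K A) M.toMod := f
    let g' : M.toMod →ₗ[Aᵐᵒᵖ] RHom A (KDual K A) N.toMod := g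
    change adj (postComp g' (f' l.1)) ((bocsDA he Θ).comul (dualGen Θ)) =
      g' (f' l.1 (dualGen Θ)) (dualGen Θ)
    rw [comul_dualGen]
    rfl

instance : (cornerFunctor Θ).Additive where
  map_add := rfl

instance : (cornerFunctor Θ).Linear K where
  map_smul {M N} f k := by
    refine FGModuleCat.hom_ext (LinearMap.ext fun m => Subtype.ext ?_)
    let f' : M.toMod →ₗ[Aᵐᵒᵖ] RHom A (KDual K A) N.toMod := f
    let m' : cornerPart e M.toMod := m
    change f' m'.1 (algebraMap K A k • dualGen Θ) =
      op (algebraMap K he.Corner k).1 • f' m'.1 (dualGen Θ)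
    rw [← map_smul, Corner.val_algebraMap, Algebra.commutes, op_mul, mul_smul, ← Central.smul_eq,
      op_e_smul_dualGen]

instance : (cornerFunctor Θ).Faithful where
  map_injective {M N} f g h := (bocsRestrict_bijective Θ).1 <| by
    exact congrArg (fun p => p.hom.hom) h

instance : (cornerFunctor Θ).Full where
  map_surjective {M N} h := by
    obtain ⟨f, hf⟩ := (bocsRestrict_bijective Θ (M := M.toMod) (N := N.toMod)).2 h.hom.hom
    exact ⟨f, FGModuleCat.hom_ext hf⟩

/-- `M` and `Hom_A(D(A), M)` are isomorphic in the module category of the bocs. -/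
lemma nonempty_iso_nuInv (M : FGModuleCat.{u} Aᵐᵒᵖ) :
    Nonempty ((⟨M⟩ : BocsMod (bocsDA he Θ)) ≅ ⟨nuInv K M⟩) := by
  have h1 := finite_cornerPart he (M := M) K
  have := finite_RHom K M
  have h2 := finite_cornerPart he (M := RHom A (KDual K A) M) K
  -- As `cornerFunctor` is fully faithful, it suffices that `I_M` restricts to a bijection `Me →
  -- Hom_A(D(A), M)e`.
  have hinj : Function.Injective (cornerRestrict he (IMap he Θ M)) := by
    refine (injective_iff_map_eq_zero _).2 fun m hm => Subtype.ext ?_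
    have h := DFunLike.congr_fun (congrArg Subtype.val hm) (dualGen Θ)
    refine Eq.trans ?_ h
    refine Eq.trans ?_ (IMap_dualTmul Θ m.1 (eAE he) (eEA he)).symm
    change m.1 = op (e * e) • m.1
    rw [he.eq]
    exact m.2.symm
  have hsurj : Function.Surjective (cornerRestrict he (IMap he Θ M)) := by
    rintro ⟨f, hf⟩
    have hf' : op e • f = f := hf
    -- For `f = f e` one gets `f(x ⊗ y) = f(e x ⊗ y) = f(e ⊗ e) x y`, so the preimage is `f(e ⊗ e)`.
    refine ⟨⟨f (dualGen Θ), ?_⟩, Subtype.ext (RHom.ext_dualTmul Θ fun x y => ?_)⟩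
    · change op e • f (dualGen Θ) = _
      rw [← map_smul, op_e_smul_dualGen]
    · refine (IMap_dualTmul Θ _ x y).trans ?_
      change op (x.1 * y.1) • f (dualGen Θ) = f (dualTmul Θ x y)
      have h1 := corner_smul_dualGen Θ (AE.toCorner he x)
      change (e * x.1) • _ = op (e * x.1) • _ at h1
      have h2 : f (dualTmul Θ x y) = (op e • f) (dualTmul Θ x y) := by rw [hf']
      rw [h2, RHom.smul_apply, unop_op, dualTmul_eq, ← mul_smul e, smul_comm (e * x.1), h1,
        op_mul e, mul_smul (op x.1), op_e_smul_dualGen, map_smul, map_smul, op_mul, mul_smul]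
  exact ⟨(cornerFunctor Θ).preimageIso
    (LinearEquiv.ofBijective _ ⟨hinj, hsurj⟩).toFGModuleCatIso⟩

/-- `X ⊗_{eAe} eA` as a finitely generated right `A`-module. -/
def extendCorner (he : IsIdempotentElem e) (X : FGModuleCat.{u} he.Cornerᵐᵒᵖ) :
    FGModuleCat.{u} Aᵐᵒᵖ :=
  have := finite_tensor_EA he (X := X)
  FGModuleCat.of Aᵐᵒᵖ (BTensor he.Corner X (EA e))

lemma nonempty_cornerFunctor_extendCorner_iso (X : FGModuleCat.{u} he.Cornerᵐᵒᵖ) :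
    Nonempty ((cornerFunctor Θ).obj ⟨extendCorner he X⟩ ≅ X) := by
  have := finite_tensor_EA he (X := X)
  have := finite_cornerPart he (M := BTensor he.Corner X (EA e)) K
  exact ⟨(baseEquivCornerPart he (X := X)).toFGModuleCatIso.symm⟩

instance : (cornerFunctor Θ).EssSurj where
  mem_essImage X := ⟨_, nonempty_cornerFunctor_extendCorner_iso Θ X⟩

instance : (cornerFunctor Θ).IsEquivalence where

end Functors

/-! ### The equivalences -/

lemma LinearEquivalent.symm {K : Type*} [Field K] {C D : Type*} [Category* C] [Category* D] [Preadditive C]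
    [Preadditive D] [Linear K C] [Linear K D] (h : LinearEquivalent K C D) :
    LinearEquivalent K D C := by
  obtain ⟨F, _, _, _⟩ := h
  have : F.asEquivalence.functor.Additive := ‹F.Additive›
  have : F.asEquivalence.functor.Linear K := ‹F.Linear K›
  exact ⟨F.asEquivalence.inverse, inferInstance, inferInstance, inferInstance⟩

lemma LinearEquivalent.trans {K : Type*} [Field K] {C D E : Type*} [Category* C] [Category* D] [Category* E]
    [Preadditive C] [Preadditive D] [Preadditive E] [Linear K C] [Linear K D] [Linear K E]
    (h : LinearEquivalent K C D) (h' : LinearEquivalent K D E) : LinearEquivalent K C E := by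
  obtain ⟨F, _, _, _⟩ := h
  obtain ⟨G, _, _, _⟩ := h'
  exact ⟨F ⋙ G, inferInstance, inferInstance, inferInstance⟩

section Equivalences

variable {K A : Type u} [Field K] [Ring A] [Algebra K A] {e : A} {he : IsIdempotentElem e}
    [FiniteDimensional K A] (Θ : BimodEquiv A A (KDual K A) (AeeA he))

lemma phi_dom2_faithful (hA : IsGendoSymmetric K he) : ((Dom2 A).ι ⋙ phiFunctor Θ).Faithful where
  map_injective {_ N} _ _ h := ObjectProperty.hom_ext _ <|
    (phi_map_bijective Θ (hA.isCornerClosed_of_two_le_domDim N.property)).1 h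

lemma phi_dom2_full (hA : IsGendoSymmetric K he) : ((Dom2 A).ι ⋙ phiFunctor Θ).Full where
  map_surjective {_ N} g := by
    obtain ⟨f, hf⟩ := (phi_map_bijective Θ (hA.isCornerClosed_of_two_le_domDim N.property)).2 g
    exact ⟨ObjectProperty.homMk f, hf⟩

lemma phi_dom2_lift_isEquivalence (hA : IsGendoSymmetric K he)
    (h : ∀ M, Dom2B he Θ (((Dom2 A).ι ⋙ phiFunctor Θ).obj M)) :
    ((Dom2B he Θ).lift ((Dom2 A).ι ⋙ phiFunctor Θ) h).IsEquivalence := by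
  have := phi_dom2_faithful Θ hA
  have := phi_dom2_full Θ hA
  have : ((Dom2B he Θ).lift ((Dom2 A).ι ⋙ phiFunctor Θ) h).EssSurj :=
    -- Density is immediate: `φ` is the identity on objects and both subcategories are cut out by
    -- the same condition.
    ⟨fun Y => ⟨⟨Y.obj.toMod, Y.property⟩, ⟨Iso.refl Y⟩⟩⟩
  exact { }

/-- For density, `X ⊗ eA` restricts to `X` but need not lie in `Dom₂`. Replacing it by `ν⁻¹(X ⊗
eA)`, which is closed and isomorphic to it in `𝓑-mod`, repairs this without changing the
restriction. -/
lemma dom2_corner_isEquivalence (hA : IsGendoSymmetric K he) :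
    (((Dom2 A).ι ⋙ phiFunctor Θ) ⋙ cornerFunctor Θ).IsEquivalence := by
  have := phi_dom2_faithful Θ hA
  have := phi_dom2_full Θ hA
  have : (((Dom2 A).ι ⋙ phiFunctor Θ) ⋙ cornerFunctor Θ).EssSurj := by
    refine ⟨fun X => ?_⟩
    obtain ⟨i⟩ := nonempty_cornerFunctor_extendCorner_iso Θ X
    obtain ⟨j⟩ := nonempty_iso_nuInv Θ (extendCorner he X)
    refine ⟨⟨nuInv K (extendCorner he X), ?_⟩, ⟨(cornerFunctor Θ).mapIso j.symm ≪≫ i⟩⟩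
    have := finite_RHom K (extendCorner he X)
    exact hA.two_le_domDim_of_isCornerClosed (isCornerClosed_rHom Θ _)
  exact { }

lemma linearEquivalent_bocsMod_corner :
    LinearEquivalent K (BocsMod (bocsDA he Θ)) (FGModuleCat.{u} he.Cornerᵐᵒᵖ) :=
  ⟨cornerFunctor Θ, inferInstance, inferInstance, inferInstance⟩

lemma linearEquivalent_dom2_corner (hA : IsGendoSymmetric K he) :
    LinearEquivalent K (Dom2 A).FullSubcategory (FGModuleCat.{u} he.Cornerᵐᵒᵖ) := by
  -- The claim does not involve the bocs, so any identification of `D(A)` with `Ae ⊗ eA` may be used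
  -- to pass through `𝓑-mod`.
  obtain ⟨Θ⟩ := hA.nonempty_dual_equiv
  exact ⟨((Dom2 A).ι ⋙ phiFunctor Θ) ⋙ cornerFunctor Θ, dom2_corner_isEquivalence Θ hA,
    inferInstance, inferInstance⟩

end Equivalences

end Gendo

theorem theorem3p3 {K A : Type u} [Field K] [Ring A] [Algebra K A] [FiniteDimensional K A]
    {e : A} (he : IsIdempotentElem e) (hA : Gendo.IsGendoSymmetric K he) :
    Nonempty (Gendo.BimodEquiv A A (Gendo.KDual K A) (Gendo.AeeA he)) ∧
    ∀ Θ : Gendo.BimodEquiv A A (Gendo.KDual K A) (Gendo.AeeA he),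
      (∃ Φ : FGModuleCat.{u} Aᵐᵒᵖ ⥤ Gendo.BocsMod (Gendo.bocsDA he Θ),
        Φ.toPrefunctor = Gendo.phi he Θ ∧ Φ.Additive ∧ Φ.Linear K ∧
        (∀ M : FGModuleCat.{u} Aᵐᵒᵖ,
          Limits.IsZero (Φ.obj M) ↔ ∀ a ∈ TwoSidedIdeal.span {e}, ∀ m : M, op a • m = 0) ∧
        (∃ h : ∀ M, Gendo.Dom2B he Θ (((Gendo.Dom2 A).ι ⋙ Φ).obj M),
          ((Gendo.Dom2B he Θ).lift ((Gendo.Dom2 A).ι ⋙ Φ) h).IsEquivalence ∧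
          ((Gendo.Dom2B he Θ).lift ((Gendo.Dom2 A).ι ⋙ Φ) h).Additive ∧
          ((Gendo.Dom2B he Θ).lift ((Gendo.Dom2 A).ι ⋙ Φ) h).Linear K)) ∧
      (∀ M : FGModuleCat.{u} Aᵐᵒᵖ, Nontrivial M →
        (∀ a ∈ TwoSidedIdeal.span {e}, ∀ m : M, op a • m = 0) → Gendo.domDim Aᵐᵒᵖ M = 0) ∧
      (∀ M : FGModuleCat.{u} Aᵐᵒᵖ, Nonempty
        ((⟨M⟩ : Gendo.BocsMod (Gendo.bocsDA he Θ)) ≅ ⟨Gendo.nuInv K M⟩)) ∧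
      Gendo.LinearEquivalent K (Gendo.BocsMod (Gendo.bocsDA he Θ))
        (Gendo.Dom2 A).FullSubcategory ∧
      Gendo.LinearEquivalent K (Gendo.Dom2 A).FullSubcategory (FGModuleCat.{u} he.Cornerᵐᵒᵖ) ∧
      Gendo.LinearEquivalent K (Gendo.BocsMod (Gendo.bocsDA he Θ))
        (FGModuleCat.{u} he.Cornerᵐᵒᵖ) := by
  refine ⟨hA.nonempty_dual_equiv, fun Θ => ?_⟩
  have hB := Gendo.linearEquivalent_bocsMod_corner Θ
  have hD := Gendo.linearEquivalent_dom2_corner hA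
  have h : ∀ M, Gendo.Dom2B he Θ (((Gendo.Dom2 A).ι ⋙ Gendo.phiFunctor Θ).obj M) :=
    fun M => M.property
  refine ⟨⟨Gendo.phiFunctor Θ, ?_, inferInstance, inferInstance, Gendo.isZero_phiFunctor_iff Θ,
    h, Gendo.phi_dom2_lift_isEquivalence Θ hA h, Gendo.phi_dom2_lift_additive Θ h,
    Gendo.phi_dom2_lift_linear Θ h⟩, fun M hM h => hA.domDim_eq_zero h,
    Gendo.nonempty_iso_nuInv Θ, hB.trans hD.symm, hD, hB⟩
  rfl
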